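/- **Setting and definitions.** Manifolds are Hausdorff and second countable and may have boundary (no corners); complex manifolds with boundary are modelled on real half-spaces of $\mathbb{C}^d$, holomorphic meaning smooth up to the boundary with complex-linear differential. A *holomorphic symplectic manifold* $(X,\Omega)$ is a complex manifold with a closed holomorphic $2$-form $\Omega$ that is non-degenerate on $T^{(1,0)}X$. A *holomorphic symplectic Lefschetz fibration* with underlying holomorphic symplectic manifold $(X,\Omega)$, $\dim_{\mathbb{C}}X=2n$, is a surjective holomorphic map $\pi:X\to C$ onto a complex one-dimensional manifold such that $\partial X=\pi^{-1}(\partial C)$, every point of $\partial X$ is a regular point of $\pi$, every critical point of $\pi$ has non-degenerate complex Hessian, and near every critical point $p$ there are holomorphic charts $(z_1,\dots,z_{2n}):U_X\to\mathbb{C}^{2n}$ of $X$ near $p$ and $\psi_C$ of $C$ near $\pi(p)$ with $$\Omega|_{U_X}=\sum_{j=1}^{n}dz_{j+n}\wedge dz_j,\qquad \psi_C\circ\pi|_{U_X}=\sum_{j=1}^{2n}z_j^2 .$$ Let $(X,\omega)$ be a real symplectic manifold of dimension $2m$ and let $\pi:X\to C$ be a smooth surjective map onto a smooth manifold of dimension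 $m$. It is a *Lagrangian fibration* of $(X,\omega)$ if there is an open dense subset $C^*\subset C$ such that $\pi:\pi^{-1}(C^*)\to C^*$ is a smooth fibre bundle with Lagrangian fibres. It is an *almost toric fibration* if, in addition, every critical point has a neighbourhood in which, in suitable charts of $X$ and $C$ and for some $0\le k<m$, one has $\omega=\sum_{j=1}^m dx_j\wedge dy_j$, $\pi_j=x_j$ for $1\le j\le k$, and the remaining components of $\pi$ are grouped into single components $\pi_j=x_j^2+y_j^2$ and consecutive pairs $(\pi_j,\pi_{j+1})=(x_jy_j+x_{j+1}y_{j+1},\;x_jy_{j+1}-x_{j+1}y_j)$. **Proposition.** Let $\pi:X\to C$ be a holomorphic symplectic Lefschetz fibration with underlying holomorphic symplectic manifold $(X,\Omega=\Omega_R+i\Omega_I)$. Assume that $X$ is connected and has real dimension four, and that $\pi$ is proper or $X$ is compact. Then: 1. $\pi$ is an almost toric fibration of $(X,\Omega_R)$; in particular, $(X,\Omega_R)$ is a symplectic manifold. 2. For every regular value $c\in C$ of $\pi$, the fibre $\pi^{-1}(c)$ is a Lagrangian submanifold of $(X,\Omega_R)$. 3. Every critical point of $\pi$ is of non-toric (focus-focus)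 type: near it there are smooth charts of $X$ and $C$ in which $\Omega_R=dx_1\wedge dy_1+dx_2\wedge dy_2$ and $\pi=(x_1y_1+x_2y_2,\;x_1y_2-x_2y_1)$. -/

import Mathlib

open scoped Manifold ContDiff
open Set

noncomputable section

namespace HoloLefschetz

universe u

section General

variable {𝕜 : Type*} [NontriviallyNormedField 𝕜]
  {E : Type*} [NormedAddCommGroup E] [NormedSpace 𝕜 E]
  {H : Type*} [TopologicalSpace H]
  {F : Type*} [NormedAddCommGroup F] [NormedSpace 𝕜 F]
  {G : Type*} [TopologicalSpace G]
  {V : Type*} [NormedAddCommGroup V] [NormedSpace 𝕜 V]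

/-- A (not necessarily continuous) `𝕜`-bilinear alternating 2-form on the manifold `M`. For
`𝕜 = ℂ` the space `TangentSpace I x` is the holomorphic tangent space at `x`. -/
abbrev TwoForm (I : ModelWithCorners 𝕜 E H) (M : Type*) [TopologicalSpace M]
    [ChartedSpace H M] : Type _ :=
  ∀ x : M, TangentSpace I x [⋀^Fin 2]→L[𝕜] 𝕜

variable {M : Type*} [TopologicalSpace M] [ChartedSpace H M]
  {N : Type*} [TopologicalSpace N] [ChartedSpace G N]

/-- The expression of a 2-form in the preferred chart at `x₀`: its pullback under the inverse
of the (extended) chart. -/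
def TwoForm.inChart (I : ModelWithCorners 𝕜 E H) (σ : TwoForm I M) (x₀ : M) (y : E) :
    E [⋀^Fin 2]→L[𝕜] 𝕜 :=
  (σ ((extChartAt I x₀).symm y)).compContinuousLinearMap
    (mfderivWithin 𝓘(𝕜, E) I (extChartAt I x₀).symm (range I) y)

/-- `σ` is a symplectic form: smooth, closed and non-degenerate. For `𝕜 = ℝ` this is a
symplectic form on a smooth manifold. For `𝕜 = ℂ`, smoothness over `ℂ` means that the coefficients
are holomorphic (and smooth up to the boundary), so this is a holomorphic
symplectic form. -/
structure IsSymplecticForm (I : ModelWithCorners 𝕜 E H) (σ : TwoForm I M) : Prop where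
  smooth : ∀ x₀ : M, ContDiffOn 𝕜 ∞ (σ.inChart I x₀) (extChartAt I x₀).target
  closed : ∀ x₀ : M, ∀ y ∈ (extChartAt I x₀).target,
    extDerivWithin (σ.inChart I x₀) (range I) y = 0
  nondegenerate : ∀ (x : M) (v : TangentSpace I x),
    (∀ w : TangentSpace I x, σ x ![v, w] = 0) → v = 0

/-- `φ` is a local coordinate system on `M` with values in the vector space `V` (of the same
dimension as `M`): a diffeomorphism from an open subset of `M` onto a subset of `V`. On the interior
of `M` the image is open by the inverse function theorem; at boundary points of `M` it
is not. For `𝕜 = ℂ`, smoothness over `ℂ` is holomorphy. -/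
structure IsLocalChart (I : ModelWithCorners 𝕜 E H) (φ : PartialEquiv M V) : Prop where
  finrank_eq : Module.finrank 𝕜 V = Module.finrank 𝕜 E
  open_source : IsOpen φ.source
  contMDiffOn : ContMDiffOn I 𝓘(𝕜, V) ∞ φ φ.source
  contMDiffOn_symm : ContMDiffOn 𝓘(𝕜, V) I ∞ φ.symm φ.target

/-- A critical point of a map between manifolds: the differential is not surjective. -/
def IsCriticalPoint (I : ModelWithCorners 𝕜 E H) (J : ModelWithCorners 𝕜 F G)
    (f : M → N) (p : M) : Prop :=
  ¬ Function.Surjective (mfderiv I J f p)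

/-- A regular value: no point of the fibre is critical. -/
def IsRegularValue (I : ModelWithCorners 𝕜 E H) (J : ModelWithCorners 𝕜 F G)
    (f : M → N) (c : N) : Prop :=
  ∀ p : M, f p = c → ¬ IsCriticalPoint I J f p

/-- The differential at `p` of a vector-valued function on a manifold, as a linear map on the
tangent space. -/
def diff (I : ModelWithCorners 𝕜 E H) (φ : M → V) (p : M) (v : TangentSpace I p) : V :=
  mfderiv I 𝓘(𝕜, V) φ p v

end General

section Complex

variable {E : Type*} [NormedAddCommGroup E] [NormedSpace ℂ E] {H : Type*} [TopologicalSpace H]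
  {HC : Type*} [TopologicalSpace HC]

/-- The model of a manifold possibly with boundary (but without corners): the full vector space
or a closed real half-space. -/
def IsBoundaryModel (I : ModelWithCorners ℂ E H) : Prop :=
  range I = univ ∨ ∃ ℓ : E →L[ℝ] ℝ, ℓ ≠ 0 ∧ range I = {z | 0 ≤ ℓ z}

/-- The same charts, seen as charts of a real manifold. -/
def realModel (I : ModelWithCorners ℂ E H) : ModelWithCorners ℝ E H where
  toPartialEquiv := I.toPartialEquiv
  source_eq := I.source_eq
  convex_range' := by
    simp only [instIsRCLikeNormedField, ↓reduceDIte]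
    exact (I.convex_range : Convex ℝ (range I)).convex_isRCLikeNormedField
  nonempty_interior' := I.nonempty_interior'
  continuous_toFun := I.continuous_toFun
  continuous_invFun := I.continuous_invFun

variable {X : Type*} [TopologicalSpace X] [ChartedSpace H X]
  {C : Type*} [TopologicalSpace C] [ChartedSpace HC C]

/-- The underlying smooth manifold of a complex manifold. -/
instance realModel_isManifold (I : ModelWithCorners ℂ E H) [IsManifold I ∞ X] :
    IsManifold (realModel I) ∞ X := by
  apply isManifold_of_contDiffOn
  intro e e' he he'
  have h := (contDiffGroupoid ∞ I).compatible he he'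
  rw [contDiffGroupoid, mem_groupoid_of_pregroupoid] at h
  exact (h.1 : ContDiffOn ℂ ∞ _ _).restrict_scalars ℝ

/-- The real part of a complex bilinear alternating form, as a real bilinear alternating form. -/
def rePart (f : E [⋀^Fin 2]→L[ℂ] ℂ) : E [⋀^Fin 2]→L[ℝ] ℝ :=
  Complex.reCLM.compContinuousAlternatingMap (f.restrictScalars ℝ)

/-- The real part of a complex 2-form, a real 2-form on the underlying smooth manifold. -/
def TwoForm.re (I : ModelWithCorners ℂ E H) (Ω : TwoForm I X) : TwoForm (realModel I) X :=
  fun x => rePart (E := E) (Ω x)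

/-- A critical point `p` of `π` is non-degenerate: the complex Hessian of `π` at `p` is
non-degenerate in some holomorphic charts of `X` and `C` (used only for interior points `p`). -/
def IsNondegenerateAt (I : ModelWithCorners ℂ E H) (IC : ModelWithCorners ℂ ℂ HC)
    (π : X → C) (p : X) : Prop :=
  ∃ (φ : PartialEquiv X E) (ψ : PartialEquiv C ℂ),
    IsLocalChart I φ ∧ IsLocalChart IC ψ ∧
    p ∈ φ.source ∧ MapsTo π φ.source ψ.source ∧
    ∀ v : E, (∀ w : E, fderiv ℂ (fderiv ℂ (ψ ∘ π ∘ φ.symm)) (φ p) v w = 0) → v = 0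

/-- A holomorphic Lefschetz fibration. -/
structure IsHolomorphicLefschetzFibration (I : ModelWithCorners ℂ E H)
    (IC : ModelWithCorners ℂ ℂ HC) (π : X → C) : Prop where
  holomorphic : ContMDiff I IC ∞ π
  surjective : Function.Surjective π
  boundary_eq : I.boundary X = π ⁻¹' IC.boundary C
  boundary_regular : ∀ p ∈ I.boundary X, ¬ IsCriticalPoint I IC π p
  nondegenerate : ∀ p, IsCriticalPoint I IC π p → IsNondegenerateAt I IC π p

/-- `π` has holomorphic Morse–Darboux charts near `p`: with `z_j = z (inl j)` and
`z_{j+n} = z (inr j)`, one has `Ω = ∑ dz_{j+n} ∧ dz_j` and `ψ_C ∘ π = ∑ z_j ^ 2`. -/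
def HasMorseDarbouxCharts (n : ℕ) (I : ModelWithCorners ℂ E H) (IC : ModelWithCorners ℂ ℂ HC)
    (Ω : TwoForm I X) (π : X → C) (p : X) : Prop :=
  ∃ (z : PartialEquiv X (EuclideanSpace ℂ (Fin n ⊕ Fin n))) (ψ : PartialEquiv C ℂ),
    IsLocalChart I z ∧ IsLocalChart IC ψ ∧
    p ∈ z.source ∧ MapsTo π z.source ψ.source ∧
    (∀ q ∈ z.source, ∀ v w : TangentSpace I q,
      Ω q ![v, w] = ∑ j : Fin n,
        (diff I z q v (.inr j) * diff I z q w (.inl j)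
          - diff I z q w (.inr j) * diff I z q v (.inl j))) ∧
    ∀ q ∈ z.source, ψ (π q) = ∑ i : Fin n ⊕ Fin n, (z q i) ^ 2

/-- A holomorphic symplectic Lefschetz fibration with underlying holomorphic symplectic manifold
`(X, Ω)` of complex dimension `2 n`. -/
structure IsHolomorphicSymplecticLefschetzFibration (n : ℕ) (I : ModelWithCorners ℂ E H)
    (IC : ModelWithCorners ℂ ℂ HC) (Ω : TwoForm I X) (π : X → C) : Prop
    extends IsHolomorphicLefschetzFibration I IC π where
  dim_eq : Module.finrank ℂ E = 2 * n
  symplectic : IsSymplecticForm I Ω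
  morseDarboux : ∀ p, IsCriticalPoint I IC π p → HasMorseDarbouxCharts n I IC Ω π p

end Complex

section Real

variable {E : Type*} [NormedAddCommGroup E] [NormedSpace ℝ E] {H : Type*} [TopologicalSpace H]
  {F : Type*} [NormedAddCommGroup F] [NormedSpace ℝ F] {G : Type*} [TopologicalSpace G]
  {X : Type u} [TopologicalSpace X] [ChartedSpace H X]
  {C : Type*} [TopologicalSpace C] [ChartedSpace G C]

/-- `π` restricts to a smooth fibre bundle over the open set `S ⊆ C`, with typical fibre some
`d`-dimensional smooth manifold `Y` (without boundary). -/
def IsFibreBundleOver (d : ℕ) (I : ModelWithCorners ℝ E H) (J : ModelWithCorners ℝ F G)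
    (π : X → C) (S : Set C) : Prop :=
  ∃ (Y : Type u) (_ : TopologicalSpace Y) (_ : ChartedSpace (EuclideanSpace ℝ (Fin d)) Y),
    IsManifold (𝓡 d) ∞ Y ∧
    ∀ c ∈ S, ∃ (U : Set C) (Φ : PartialEquiv X (C × Y)),
      IsOpen U ∧ c ∈ U ∧ U ⊆ S ∧
      Φ.source = π ⁻¹' U ∧ Φ.target = U ×ˢ univ ∧
      ContMDiffOn I (J.prod (𝓡 d)) ∞ Φ Φ.source ∧
      ContMDiffOn (J.prod (𝓡 d)) I ∞ Φ.symm Φ.target ∧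
      ∀ x ∈ Φ.source, (Φ x).1 = π x

/-- The fibre of `π` over `c` is a (regular) Lagrangian submanifold: `π` is a submersion along
the fibre, and the tangent space `ker dπ` of the fibre equals its own `σ`-orthogonal complement. -/
def IsLagrangianFibre (I : ModelWithCorners ℝ E H) (J : ModelWithCorners ℝ F G)
    (σ : TwoForm I X) (π : X → C) (c : C) : Prop :=
  ∀ x : X, π x = c → ¬ IsCriticalPoint I J π x ∧
    ∀ v : TangentSpace I x, mfderiv I J π x v = 0 ↔
      ∀ w : TangentSpace I x, mfderiv I J π x w = 0 → σ x ![v, w] = 0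

/-- A Lagrangian fibration of the symplectic manifold `(X, σ)` of dimension `2 m` over a
manifold `C` of dimension `m`. -/
structure IsLagrangianFibration (m : ℕ) (I : ModelWithCorners ℝ E H) (J : ModelWithCorners ℝ F G)
    [IsManifold I ∞ X] [IsManifold J ∞ C] (σ : TwoForm I X) (π : X → C) : Prop where
  dim_total : Module.finrank ℝ E = 2 * m
  dim_base : Module.finrank ℝ F = m
  symplectic : IsSymplecticForm I σ
  smooth : ContMDiff I J ∞ π
  surjective : Function.Surjective π
  lagrangian : ∃ S : Set C, IsOpen S ∧ Dense S ∧ IsFibreBundleOver m I J π S ∧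
    ∀ c ∈ S, IsLagrangianFibre I J σ π c

/-- The possible block patterns of the local form at a critical point, with coordinates indexed by
`0, …, m - 1`: the first `k < m` coordinates of the map are regular, `T` is the set of first
indices of the focus-focus blocks `(j, j + 1)`, and all the other indices are elliptic. -/
def IsBlockPattern (m k : ℕ) (T : Set (Fin m)) : Prop :=
  k < m ∧ ∀ i ∈ T, k ≤ (i : ℕ) ∧ ∃ j : Fin m, (j : ℕ) = i + 1 ∧ j ∉ T

/-- The local form of an almost toric map `(q_j)` in the coordinates `(x_j, y_j)`. -/
def IsAlmostToricForm {m : ℕ} (k : ℕ) (T : Set (Fin m)) (x y q : Fin m → ℝ) : Prop :=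
  (∀ j : Fin m, (j : ℕ) < k → q j = x j) ∧
  (∀ i j : Fin m, i ∈ T → (j : ℕ) = i + 1 →
    q i = x i * y i + x j * y j ∧ q j = x i * y j - x j * y i) ∧
  (∀ j : Fin m, k ≤ (j : ℕ) → j ∉ T → (∀ i ∈ T, (j : ℕ) ≠ i + 1) → q j = x j ^ 2 + y j ^ 2)

/-- Near `p`, in suitable charts of `X` (with `x_j = z (inl j)` and `y_j = z (inr j)`) and of `C`,
one has `σ = ∑ dx_j ∧ dy_j` and `π` has the almost toric local form with block pattern
`(k, T)`. -/
def HasAlmostToricCharts (m : ℕ) (I : ModelWithCorners ℝ E H) (J : ModelWithCorners ℝ F G)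
    (σ : TwoForm I X) (π : X → C) (k : ℕ) (T : Set (Fin m)) (p : X) : Prop :=
  ∃ (z : PartialEquiv X (EuclideanSpace ℝ (Fin m ⊕ Fin m)))
    (ψ : PartialEquiv C (EuclideanSpace ℝ (Fin m))),
    IsLocalChart I z ∧ IsLocalChart J ψ ∧
    p ∈ z.source ∧ MapsTo π z.source ψ.source ∧
    (∀ q ∈ z.source, ∀ v w : TangentSpace I q,
      σ q ![v, w] = ∑ j : Fin m,
        (diff I z q v (.inl j) * diff I z q w (.inr j)
          - diff I z q w (.inl j) * diff I z q v (.inr j))) ∧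
    ∀ q ∈ z.source,
      IsAlmostToricForm k T (fun j => z q (.inl j)) (fun j => z q (.inr j)) (fun j => ψ (π q) j)

/-- An almost toric fibration of the symplectic manifold `(X, σ)` of dimension `2 m`. -/
structure IsAlmostToricFibration (m : ℕ) (I : ModelWithCorners ℝ E H) (J : ModelWithCorners ℝ F G)
    [IsManifold I ∞ X] [IsManifold J ∞ C] (σ : TwoForm I X) (π : X → C) : Prop
    extends IsLagrangianFibration m I J σ π where
  localForm : ∀ p, IsCriticalPoint I J π p →
    ∃ (k : ℕ) (T : Set (Fin m)), IsBlockPattern m k T ∧ HasAlmostToricCharts m I J σ π k T p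

/-- In dimension four, `p` is of non-toric (focus-focus) type: near `p` one has
`σ = dx₁ ∧ dy₁ + dx₂ ∧ dy₂` and `π = (x₁ y₁ + x₂ y₂, x₁ y₂ - x₂ y₁)` in suitable charts. -/
def IsFocusFocusPoint (I : ModelWithCorners ℝ E H) (J : ModelWithCorners ℝ F G)
    (σ : TwoForm I X) (π : X → C) (p : X) : Prop :=
  HasAlmostToricCharts 2 I J σ π 0 {0} p

end Real

end HoloLefschetz

end

open HoloLefschetz

/-! The symplectic assertions are linear algebra. Taking real parts is real-linear, so it commutes
with the exterior derivative, and `Re Ω(v, i w) = -Im Ω(v, w)` transfers non-degeneracy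
(`IsSymplecticForm.re`). At a regular point `ker dπ` is a complex line in a complex symplectic
plane; an alternating complex form vanishes on a line, and by dimension the line is its own
orthogonal complement, already for the real part (`mem_ker_iff_forall_re_eq_zero`). At a critical
point the Morse–Darboux chart gives `ψ ∘ π = a² + b² = (a + i b)(a - i b)`; a linear change of
coordinates and real and imaginary parts turn this into the focus-focus normal form
(`HasMorseDarbouxCharts.isFocusFocusPoint`).

The longer part is to find an open dense set over which `π` is a smooth bundle with a single typical
fibre. The set chosen is that of the regular values in the interior of `C`. Critical points are
isolated and `π` is closed, so critical values are isolated as well; hence the set is open and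
dense. It is also connected, since `C` is, and since deleting a point does not disconnect a convex
open subset of the plane (`exists_isPreconnected_subset_closure`,
`isPreconnected_of_locally_subset_closure`).

Local triviality is Ehresmann's theorem, proved without flows (`exists_isTrivialization`). A compact
fibre embeds in a Euclidean space, nearest points give a smooth retraction `r` onto it
(`SliceFamily.exists_retraction`), and `x ↦ (π x, r x)` trivializes `π` near the fibre.
Connectedness then makes all typical fibres diffeomorphic (`isFibreBundleOver_of_isPreconnected`).
-/

noncomputable section

namespace HoloLefschetz

universe u

open Filter Topology

/-! ### Inverse function theorem and smooth dependence of nearest points. -/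

section InverseFunction

variable {E F : Type*} [NormedAddCommGroup E] [NormedSpace ℝ E] [NormedAddCommGroup F]
  [NormedSpace ℝ F]

/-- The inverse function theorem, with smoothness on open sets. -/
theorem exists_openPartialHomeomorph_of_contDiffOn [CompleteSpace E] {f : E → F} {O : Set E}
    (hO : IsOpen O) (hf : ContDiffOn ℝ ∞ f O) {a : E} (ha : a ∈ O) (f' : E ≃L[ℝ] F)
    (hf' : HasFDerivAt f (f' : E →L[ℝ] F) a) :
    ∃ e : OpenPartialHomeomorph E F, a ∈ e.source ∧ e.source ⊆ O ∧ (∀ x, e x = f x) ∧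
      ContDiffOn ℝ ∞ e.symm e.target := by
  have hfa : ContDiffAt ℝ ∞ f a := hf.contDiffAt (hO.mem_nhds ha)
  let e₀ := hfa.toOpenPartialHomeomorph f hf' (by simp)
  have hc : ContinuousOn (fderiv ℝ f) O := hf.continuousOn_fderiv_of_isOpen hO (by simp)
  -- Restricting to points with invertible derivative makes the inverse smooth on the whole target,
  -- not only at the image of `a`.
  have hU : IsOpen (O ∩ fderiv ℝ f ⁻¹' range ((↑) : (E ≃L[ℝ] F) → E →L[ℝ] F)) :=
    hc.isOpen_inter_preimage hO ContinuousLinearEquiv.isOpen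
  refine ⟨e₀.restrOpen _ hU, ?_, ?_, fun x => rfl, ?_⟩
  · exact ⟨hfa.mem_toOpenPartialHomeomorph_source hf' (by simp), ha, f', hf'.fderiv.symm⟩
  · exact fun x hx => hx.2.1
  · intro y hy
    have hy' := (e₀.restrOpen _ hU).map_target hy
    obtain ⟨g, hg⟩ := hy'.2.2
    have hyO : (e₀.restrOpen _ hU).symm y ∈ O := hy'.2.1
    have hd : ContDiffAt ℝ ∞ f ((e₀.restrOpen _ hU).symm y) := hf.contDiffAt (hO.mem_nhds hyO)
    refine (OpenPartialHomeomorph.contDiffAt_symm (e₀.restrOpen _ hU) (f₀' := g) hy ?_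
      hd).contDiffWithinAt
    rw [hg]
    exact (hd.differentiableAt (by simp)).hasFDerivAt

/-- Near a point where `b` is an immersion, the nearest point on the image of `b` depends
smoothly on the given point. -/
theorem exists_contDiffOn_eq_of_isLocalMin [FiniteDimensional ℝ E] {R : Type*}
    [NormedAddCommGroup R] [InnerProductSpace ℝ R] [FiniteDimensional ℝ R] {b : E → R} {V : Set E}
    (hV : IsOpen V) (hb : ContDiffOn ℝ ∞ b V) {v₀ : E} (hv₀ : v₀ ∈ V)
    (hinj : Function.Injective (fderiv ℝ b v₀)) :
    ∃ (s : R → E) (P : Set R) (Q : Set E), IsOpen P ∧ b v₀ ∈ P ∧ IsOpen Q ∧ v₀ ∈ Q ∧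
      ContDiffOn ℝ ∞ s P ∧
      ∀ y ∈ P, ∀ v ∈ Q, IsLocalMin (fun w => ‖y - b w‖ ^ 2) v → v = s y := by
  have := FiniteDimensional.complete ℝ E
  have := FiniteDimensional.complete ℝ R
  -- The first component is `-1/2` times the differential at `v` of the squared distance from `y` to
  -- `b v`. So minimizers `v` satisfy `G (v, y) = (0, y)`, and local invertibility of `G` leaves
  -- only one near `v₀`.
  let G : E × R → (E →L[ℝ] ℝ) × R :=
    fun p => ((innerSL ℝ (p.2 - b p.1)).comp (fderiv ℝ b p.1), p.2)
  have hbf : ContDiffOn ℝ ∞ (fun p : E × R => b p.1) (V ×ˢ univ) :=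
    hb.comp contDiffOn_fst (fun p hp => hp.1)
  have hdb : ContDiffOn ℝ ∞ (fun p : E × R => fderiv ℝ b p.1) (V ×ˢ univ) :=
    (hb.fderiv_of_isOpen hV (m := ∞) (by simp)).comp contDiffOn_fst (fun p hp => hp.1)
  have hG : ContDiffOn ℝ ∞ G (V ×ˢ univ) := by
    refine ContDiffOn.prodMk ?_ contDiffOn_snd
    refine ContDiffOn.clm_comp ?_ hdb
    exact (innerSL ℝ).contDiff.comp_contDiffOn (contDiffOn_snd.sub hbf)
  let A := fderiv ℝ b v₀
  have hA : HasFDerivAt b A v₀ :=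
    ((hb.contDiffAt (hV.mem_nhds hv₀)).differentiableAt (by simp)).hasFDerivAt
  let T : E × R →L[ℝ] (E →L[ℝ] ℝ) × R :=
    ((((ContinuousLinearMap.compL ℝ E R ℝ).flip A).comp (innerSL ℝ)).comp
      (ContinuousLinearMap.snd ℝ E R - A.comp (ContinuousLinearMap.fst ℝ E R))).prod
      (ContinuousLinearMap.snd ℝ E R)
  have hT : HasFDerivAt G T (v₀, b v₀) := by
    refine HasFDerivAt.prodMk ?_ hasFDerivAt_snd
    have h1 : HasFDerivAt (fun p : E × R => innerSL ℝ (p.2 - b p.1))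
        ((innerSL ℝ : R →L[ℝ] R →L[ℝ] ℝ).comp
          (ContinuousLinearMap.snd ℝ E R - A.comp (ContinuousLinearMap.fst ℝ E R))) (v₀, b v₀) := by
      refine (innerSL ℝ : R →L[ℝ] R →L[ℝ] ℝ).hasFDerivAt.comp _ ?_
      exact hasFDerivAt_snd.sub (HasFDerivAt.comp (v₀, b v₀) (g := b) hA hasFDerivAt_fst)
    have h2 : HasFDerivAt (fun p : E × R => fderiv ℝ b p.1)
        (fderiv ℝ (fun p : E × R => fderiv ℝ b p.1) (v₀, b v₀)) (v₀, b v₀) :=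
      ((hdb.contDiffAt ((hV.prod isOpen_univ).mem_nhds ⟨hv₀, mem_univ _⟩)).differentiableAt
        (by simp)).hasFDerivAt
    -- The second derivative of `b` is paired with `b v₀ - b v₀ = 0`, so `T` involves only `A`. What
    -- remains on the `E` factor is minus the Gram form of the injective map `A`.
    refine (h1.clm_comp h2).congr_fderiv ?_
    ext p w
    all_goals simp [A]
  have hTinj : Function.Injective T := by
    rw [injective_iff_map_eq_zero]
    rintro ⟨w, z⟩ h
    have hz : z = 0 := congrArg Prod.snd h
    subst hz
    have h1 : (innerSL ℝ (-(A w))).comp A = 0 := by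
      have := congrArg Prod.fst h
      simpa [T] using this
    have h2 := DFunLike.congr_fun h1 w
    have h3 : A w = 0 := by simpa using h2
    have : w = 0 := hinj (by simpa using h3)
    simp [this]
  have hfin : Module.finrank ℝ (E × R) = Module.finrank ℝ ((E →L[ℝ] ℝ) × R) := by
    have : Module.finrank ℝ (E →L[ℝ] ℝ) = Module.finrank ℝ E := by
      rw [← Subspace.dual_finrank_eq (K := ℝ) (V := E)]
      exact (LinearMap.toContinuousLinearMap (𝕜 := ℝ) (E := E) (F' := ℝ)).finrank_eq.symm
    simp [this]
  let T' : (E × R) ≃L[ℝ] (E →L[ℝ] ℝ) × R :=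
    (LinearMap.linearEquivOfInjective (T : E × R →ₗ[ℝ] (E →L[ℝ] ℝ) × R) hTinj
      hfin).toContinuousLinearEquiv
  obtain ⟨e, hae, heO, hef, hes⟩ := exists_openPartialHomeomorph_of_contDiffOn
    (hV.prod isOpen_univ) hG (a := (v₀, b v₀)) ⟨hv₀, mem_univ _⟩ T' hT
  obtain ⟨Q, P, hQ, hvQ, hP, hbP, hPQ⟩ := mem_nhds_prod_iff'.1 (e.open_source.mem_nhds hae)
  have hcont : Continuous (fun y : R => ((0 : E →L[ℝ] ℝ), y)) := by fun_prop
  have hG0 : G (v₀, b v₀) = (0, b v₀) := by simp [G]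
  refine ⟨fun y => (e.symm (0, y)).1, P ∩ (fun y : R => ((0 : E →L[ℝ] ℝ), y)) ⁻¹' e.target, Q,
    hP.inter (e.open_target.preimage hcont), ⟨hbP, ?_⟩, hQ, hvQ, ?_, ?_⟩
  · have := e.map_source hae
    rwa [hef, hG0] at this
  · refine contDiff_fst.comp_contDiffOn (hes.comp ?_ (fun y hy => hy.2))
    exact (contDiff_const.prodMk contDiff_id).contDiffOn
  · rintro y ⟨hyP, -⟩ v hv hmin
    have hs : (v, y) ∈ e.source := hPQ ⟨hv, hyP⟩
    have hvV : v ∈ V := (heO hs).1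
    have hd : HasFDerivAt b (fderiv ℝ b v) v :=
      ((hb.contDiffAt (hV.mem_nhds hvV)).differentiableAt (by simp)).hasFDerivAt
    have hz := hmin.hasFDerivAt_eq_zero ((hd.const_sub y).norm_sq)
    have : e (v, y) = (0, y) := by
      rw [hef]
      refine Prod.ext ?_ rfl
      ext w
      have := DFunLike.congr_fun hz w
      have h0 : inner ℝ (b v) (fderiv ℝ b v w) - inner ℝ y (fderiv ℝ b v w) = 0 := by
        simpa using this
      have h1 : inner ℝ y (fderiv ℝ b v w) - inner ℝ (b v) (fderiv ℝ b v w) = 0 := by linarith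
      simpa [G, inner_sub_left] using h1
    simp only [← this, e.left_inv hs]

end InverseFunction

/-! ### Manifold structure on a subset covered by slices. -/

section Slices

variable {E : Type*} [NormedAddCommGroup E] [NormedSpace ℝ E] {H : Type*} [TopologicalSpace H]
  {I : ModelWithCorners ℝ E H} {M : Type u} [TopologicalSpace M] [ChartedSpace H M] {d : ℕ}

/-- `φ` is a `d`-dimensional coordinate system on `O ∩ s` which extends smoothly to the open
subset `O` of the manifold `M`, with smooth inverse. -/
structure IsSlice (I : ModelWithCorners ℝ E H) (s O : Set M)
    (φ : PartialEquiv M (EuclideanSpace ℝ (Fin d))) : Prop where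
  isOpen : IsOpen O
  source_eq : φ.source = O ∩ s
  open_target : IsOpen φ.target
  contMDiffOn : ContMDiffOn I (𝓡 d) ∞ φ O
  contMDiffOn_symm : ContMDiffOn (𝓡 d) I ∞ φ.symm φ.target

variable {s O : Set M} {φ : PartialEquiv M (EuclideanSpace ℝ (Fin d))}

/-- The coordinate system of a slice as a chart of the subset. -/
def IsSlice.chart (h : IsSlice I s O φ) (x₀ : s) :
    OpenPartialHomeomorph s (EuclideanSpace ℝ (Fin d)) where
  toFun x := φ x
  -- The default `x₀` is never used on the target, which `φ.symm` maps into `s`.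
  invFun v := open Classical in if hv : φ.symm v ∈ s then ⟨φ.symm v, hv⟩ else x₀
  source := Subtype.val ⁻¹' O
  target := φ.target
  map_source' x hx := φ.map_source (by rw [h.source_eq]; exact ⟨hx, x.2⟩)
  map_target' v hv := by
    have := φ.map_target hv
    rw [h.source_eq] at this
    simpa [this.2] using this.1
  left_inv' x hx := by
    have : φ.symm (φ x) = x := φ.left_inv (by rw [h.source_eq]; exact ⟨hx, x.2⟩)
    simp [this]
  right_inv' v hv := by
    have h1 := φ.map_target hv
    rw [h.source_eq] at h1
    simpa [h1.2] using φ.right_inv hv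
  open_source := h.isOpen.preimage continuous_subtype_val
  open_target := h.open_target
  continuousOn_toFun := h.contMDiffOn.continuousOn.comp continuous_subtype_val.continuousOn
    (fun _ hx => hx)
  continuousOn_invFun := by
    rw [Topology.IsInducing.subtypeVal.continuousOn_iff]
    refine h.contMDiffOn_symm.continuousOn.congr fun v hv => ?_
    have h1 := φ.map_target hv
    rw [h.source_eq] at h1
    simp [h1.2]

theorem IsSlice.coe_chart_symm (h : IsSlice I s O φ) (x₀ : s) {v : EuclideanSpace ℝ (Fin d)}
    (hv : v ∈ φ.target) : ((h.chart x₀).symm v : M) = φ.symm v := by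
  have h1 := φ.map_target hv
  rw [h.source_eq] at h1
  classical
  change ((if hv : φ.symm v ∈ s then ⟨φ.symm v, hv⟩ else x₀ : s) : M) = _
  simp [h1.2]

/-- A family of slices covering the subset `s`. -/
structure SliceFamily (I : ModelWithCorners ℝ E H) (d : ℕ) (s : Set M) where
  dom : s → Set M
  coord : s → PartialEquiv M (EuclideanSpace ℝ (Fin d))
  isSlice : ∀ x, IsSlice I s (dom x) (coord x)
  mem_dom : ∀ x : s, (x : M) ∈ dom x

/-- A subset covered by slices is a manifold. -/
abbrev SliceFamily.chartedSpace (S : SliceFamily I d s) :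
    ChartedSpace (EuclideanSpace ℝ (Fin d)) s where
  atlas := range fun x => (S.isSlice x).chart x
  chartAt x := (S.isSlice x).chart x
  mem_chart_source x := S.mem_dom x
  chart_mem_atlas x := ⟨x, rfl⟩

theorem SliceFamily.isManifold (S : SliceFamily I d s) :
    letI := S.chartedSpace
    IsManifold (𝓡 d) ∞ s := by
  let _ := S.chartedSpace
  apply isManifold_of_contDiffOn
  rintro _ _ ⟨x, rfl⟩ ⟨y, rfl⟩
  simp only [modelWithCornersSelf_coe, modelWithCornersSelf_coe_symm, Function.id_comp,
    Function.comp_id, range_id, inter_univ, preimage_id]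
  rw [← contMDiffOn_iff_contDiffOn]
  have h := (S.isSlice y).contMDiffOn.comp ((S.isSlice x).contMDiffOn_symm.mono
    (t := (((S.isSlice x).chart x).symm.trans ((S.isSlice y).chart y)).source)
    (fun v hv => hv.1)) (fun v hv => ?_)
  · refine h.congr fun v hv => ?_
    have := (S.isSlice x).coe_chart_symm x (v := v) hv.1
    exact congrArg (S.coord y) this
  · have := (S.isSlice x).coe_chart_symm x (v := v) hv.1
    rw [mem_preimage, ← this]
    exact hv.2

theorem SliceFamily.contMDiff_coe (S : SliceFamily I d s) :
    letI := S.chartedSpace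
    ContMDiff (𝓡 d) I ∞ (Subtype.val : s → M) := by
  let _ := S.chartedSpace
  have := S.isManifold
  intro x
  have hx : x ∈ ((S.isSlice x).chart x).source := S.mem_dom x
  have h1 : ContMDiffAt (𝓡 d) (𝓡 d) ∞ ((S.isSlice x).chart x) x :=
    contMDiffAt_of_mem_maximalAtlas (IsManifold.chart_mem_maximalAtlas (I := 𝓡 d) x) hx
  have hxt := ((S.isSlice x).chart x).map_source hx
  have h2 := ((S.isSlice x).contMDiffOn_symm _ hxt).contMDiffAt
    ((S.isSlice x).open_target.mem_nhds hxt)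
  refine (h2.comp x h1).congr_of_eventuallyEq ?_
  filter_upwards [((S.isSlice x).chart x).open_source.mem_nhds hx] with y hy
  have := (S.isSlice x).coe_chart_symm x (((S.isSlice x).chart x).map_source hy)
  rw [((S.isSlice x).chart x).left_inv hy] at this
  exact this

/-- Slice coordinates are smooth on open subsets of the ambient manifold, so they may be composed
with the ambient map. This is what makes a retraction smooth as a map into the fibre. -/
theorem SliceFamily.contMDiffAt_of_coe (S : SliceFamily I d s) {E' : Type*}
    [NormedAddCommGroup E'] [NormedSpace ℝ E'] {H' : Type*} [TopologicalSpace H']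
    {I' : ModelWithCorners ℝ E' H'} {N : Type*} [TopologicalSpace N] [ChartedSpace H' N]
    {f : N → s} {p : N}
    (hf : ContMDiffAt I' I ∞ (fun q => (f q : M)) p) :
    letI := S.chartedSpace
    ContMDiffAt I' (𝓡 d) ∞ f p := by
  let _ := S.chartedSpace
  have := S.isManifold
  have hx : f p ∈ ((S.isSlice (f p)).chart (f p)).source := S.mem_dom (f p)
  have hxt := ((S.isSlice (f p)).chart (f p)).map_source hx
  have hc : ContinuousAt f p := Topology.IsInducing.subtypeVal.continuousAt_iff.2 hf.continuousAt
  have h1 : ContMDiffAt I' (𝓡 d) ∞ (fun q => S.coord (f p) (f q)) p :=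
    (((S.isSlice (f p)).contMDiffOn _ (S.mem_dom (f p))).contMDiffAt
      ((S.isSlice (f p)).isOpen.mem_nhds (S.mem_dom (f p)))).comp p hf
  have h2 : ContMDiffAt (𝓡 d) (𝓡 d) ∞ ((S.isSlice (f p)).chart (f p)).symm
      (S.coord (f p) (f p)) :=
    ((contMDiffOn_symm_of_mem_maximalAtlas (IsManifold.chart_mem_maximalAtlas (I := 𝓡 d) (f p))) _
      hxt).contMDiffAt (((S.isSlice (f p)).chart (f p)).open_target.mem_nhds hxt)
  refine (h2.comp p h1).congr_of_eventuallyEq ?_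
  filter_upwards [hc.preimage_mem_nhds
    (((S.isSlice (f p)).chart (f p)).open_source.mem_nhds hx)] with q hq
  exact (((S.isSlice (f p)).chart (f p)).left_inv hq).symm

end Slices

/-! ### Euclidean embedding of a compact submanifold and its smooth neighbourhood retraction. -/

section Retraction

variable {E : Type*} [NormedAddCommGroup E] [NormedSpace ℝ E] [FiniteDimensional ℝ E]
  {H : Type*} [TopologicalSpace H] {I : ModelWithCorners ℝ E H} {M : Type u} [TopologicalSpace M]
  [T2Space M] [ChartedSpace H M] [IsManifold I ∞ M] {d : ℕ} {s : Set M}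

/-- A compact subset covered by slices has an embedding, defined on the whole manifold, into a
Euclidean space. -/
theorem SliceFamily.exists_embedding (S : SliceFamily I d s) (hs : IsCompact s) :
    ∃ (m : ℕ) (e : M → EuclideanSpace ℝ (Fin m)), ContMDiff I (𝓡 m) ∞ e ∧ InjOn e s ∧
      ∀ x ∈ s, ∃ y : s, x ∈ S.dom y ∧
        ∃ L : EuclideanSpace ℝ (Fin m) →L[ℝ] EuclideanSpace ℝ (Fin d),
          ∀ᶠ z in 𝓝 x, L (e z) = S.coord y z := by
  have hb : ∀ x : s, ∃ ρ : SmoothBumpFunction I (x : M), tsupport ρ ⊆ S.dom x := fun x => by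
    obtain ⟨ρ, -, h⟩ := (SmoothBumpFunction.nhds_basis_tsupport (I := I) (x : M)).mem_iff.1
      ((S.isSlice x).isOpen.mem_nhds (S.mem_dom x))
    exact ⟨ρ, h⟩
  choose ρ hρ using hb
  obtain ⟨t, ht⟩ := hs.elim_nhds_subcover' (fun x hx => {y | ∀ᶠ z in 𝓝 y, ρ ⟨x, hx⟩ z = 1})
    (fun x hx => ((ρ ⟨x, hx⟩).eventuallyEq_one).eventually_nhds)
  let R := t → ℝ × EuclideanSpace ℝ (Fin d)
  -- As in Whitney's embedding, `ρ i` marks where the `i`-th coordinates are valid and the second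
  -- entry records them. Where `ρ i = 1` the coordinates are recovered by a linear projection, which
  -- supplies `L`.
  let e₀ : M → R := fun z i => (ρ i z, ρ i z • S.coord i z)
  have he₀ : ContMDiff I 𝓘(ℝ, R) ∞ e₀ := by
    refine contMDiff_pi_space.2 fun i => ?_
    refine ContMDiff.prodMk_space (ρ i).contMDiff ?_
    refine contMDiff_of_tsupport fun x hx => ?_
    have hx' : x ∈ S.dom i := hρ i (tsupport_smul_subset_left _ _ hx)
    exact (ρ i).contMDiffAt.smul (((S.isSlice i).contMDiffOn _ hx').contMDiffAt
      ((S.isSlice i).isOpen.mem_nhds hx'))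
  let T : R ≃L[ℝ] EuclideanSpace ℝ (Fin (Module.finrank ℝ R)) := toEuclidean
  refine ⟨Module.finrank ℝ R, fun z => T (e₀ z), T.contDiff.contMDiff.comp he₀, ?_, ?_⟩
  · intro x hx y hy hxy
    have h : e₀ x = e₀ y := T.injective hxy
    obtain ⟨i, hit, hi⟩ := mem_iUnion₂.1 (ht hx)
    have h1 : ρ i x = 1 := (show ∀ᶠ z in 𝓝 x, ρ i z = 1 from hi).self_of_nhds
    have hc := congrFun h ⟨i, hit⟩
    have h2 : ρ i y = 1 := by rw [← h1]; exact (congrArg Prod.fst hc).symm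
    have h3 : S.coord i x = S.coord i y := by
      have := congrArg Prod.snd hc
      simpa [e₀, h1, h2] using this
    have hdom : ∀ z, ρ i z = 1 → z ∈ S.dom i := fun z hz =>
      hρ i (subset_tsupport _ (by simp [hz]))
    refine (S.coord i).injOn ?_ ?_ h3
    · rw [(S.isSlice i).source_eq]; exact ⟨hdom _ h1, hx⟩
    · rw [(S.isSlice i).source_eq]; exact ⟨hdom _ h2, hy⟩
  · intro x hx
    obtain ⟨i, hit, hi⟩ := mem_iUnion₂.1 (ht hx)
    have hi' : ∀ᶠ z in 𝓝 x, ρ i z = 1 := hi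
    have h1 : ρ i x = 1 := hi'.self_of_nhds
    refine ⟨i, hρ i (subset_tsupport _ (by simp [h1])),
      ((ContinuousLinearMap.snd ℝ ℝ (EuclideanSpace ℝ (Fin d))).comp
        (ContinuousLinearMap.proj (R := ℝ) (φ := fun _ : t => ℝ × EuclideanSpace ℝ (Fin d))
          ⟨i, hit⟩)).comp (T.symm : _ →L[ℝ] R), ?_⟩
    filter_upwards [hi'] with z hz
    simp [e₀, hz]

/-- A compact subset covered by slices is a smooth neighbourhood retract. -/
theorem SliceFamily.exists_retraction (S : SliceFamily I d s) (hs : IsCompact s) :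
    ∃ (r : M → M) (W : Set M), IsOpen W ∧ s ⊆ W ∧ ContMDiffOn I I ∞ r W ∧ MapsTo r W s ∧
      ∀ x ∈ s, r x = x := by
  rcases s.eq_empty_or_nonempty with rfl | hne
  · exact ⟨id, ∅, isOpen_empty, empty_subset _, contMDiffOn_id, mapsTo_empty _ _, by simp⟩
  obtain ⟨m, e, he, hinj, hloc⟩ := S.exists_embedding hs
  have hmin : ∀ x : M, ∃ y ∈ s, ∀ z ∈ s, ‖e x - e y‖ ^ 2 ≤ ‖e x - e z‖ ^ 2 := fun x => by
    obtain ⟨y, hy, h⟩ := hs.exists_isMinOn hne (f := fun z => ‖e x - e z‖ ^ 2)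
      (by have := he.continuous; fun_prop)
    exact ⟨y, hy, fun z hz => h hz⟩
  -- An arbitrary choice among the nearest points. Near `s` it is forced: continuity along `s`
  -- brings the nearest point into one chart, where the critical point of the distance is unique and
  -- smooth in the data.
  choose r hrs hr using hmin
  have hfix : ∀ x ∈ s, r x = x := fun x hx => by
    have h := hr x x hx
    have : e x - e (r x) = 0 := by
      rw [sub_self, norm_zero, zero_pow two_ne_zero] at h
      exact norm_eq_zero.1 (pow_eq_zero_iff two_ne_zero |>.1 (le_antisymm h (sq_nonneg _)))
    exact (hinj hx (hrs x) (sub_eq_zero.1 this)).symm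
  have hcont : ∀ x ∈ s, ContinuousAt r x := fun x hx => by
    rw [ContinuousAt, hfix x hx, tendsto_def]
    intro V hV
    obtain ⟨V', hV'V, hV'o, hxV'⟩ := mem_nhds_iff.1 hV
    have hec := he.continuous
    -- For `z` near `x`, every point of the compact set `s \ V'` is farther from `z` than `x` is, so
    -- no nearest point lies there.
    have hopen : IsOpen {p : M × M | ‖e p.1 - e x‖ ^ 2 < ‖e p.1 - e p.2‖ ^ 2} :=
      isOpen_lt (by fun_prop) (by fun_prop)
    obtain ⟨A, B, hA, -, hxA, hB, hAB⟩ := generalized_tube_lemma (isCompact_singleton (x := x))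
      (hs.diff hV'o) hopen (by
        rintro ⟨a, b⟩ ⟨ha, hb⟩
        obtain rfl : a = x := ha
        have hne : e a - e b ≠ 0 := fun h0 =>
          hb.2 (hinj hx hb.1 (sub_eq_zero.1 h0) ▸ hxV')
        have : 0 < ‖e a - e b‖ := norm_pos_iff.2 hne
        change ‖e a - e a‖ ^ 2 < ‖e a - e b‖ ^ 2
        rw [sub_self, norm_zero, zero_pow two_ne_zero]
        positivity)
    filter_upwards [hA.mem_nhds (hxA rfl)] with z hz
    by_contra hzV
    have h1 : ‖e z - e x‖ ^ 2 < ‖e z - e (r z)‖ ^ 2 :=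
      @hAB (z, r z) ⟨hz, hB ⟨hrs z, fun h => hzV (hV'V h)⟩⟩
    exact absurd (hr z x hx) (not_le.2 h1)
  have hsm : ∀ x ∈ s, ∀ᶠ z in 𝓝 x, ContMDiffAt I I ∞ r z := fun x hx => by
    obtain ⟨y, hxy, L, hL⟩ := hloc x hx
    have hφ := S.isSlice y
    set φ := S.coord y
    have hxφ : x ∈ φ.source := by rw [hφ.source_eq]; exact ⟨hxy, hx⟩
    have hb : ContDiffOn ℝ ∞ (fun v => e (φ.symm v)) φ.target :=
      contMDiffOn_iff_contDiffOn.1 (he.comp_contMDiffOn hφ.contMDiffOn_symm)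
    have hsymm : φ.symm (φ x) = x := φ.left_inv hxφ
    have hLb : ∀ᶠ v in 𝓝 (φ x), L (e (φ.symm v)) = v := by
      have hc : ContinuousAt φ.symm (φ x) := hφ.contMDiffOn_symm.continuousOn.continuousAt
        (hφ.open_target.mem_nhds (φ.map_source hxφ))
      have := hc.eventually (p := fun z => L (e z) = φ z) (by rwa [hsymm])
      filter_upwards [this, hφ.open_target.mem_nhds (φ.map_source hxφ)] with v hv hvt
      rw [hv, φ.right_inv hvt]
    have hinj' : Function.Injective (fderiv ℝ (fun v => e (φ.symm v)) (φ x)) := by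
      have hd : HasFDerivAt (fun v => e (φ.symm v)) (fderiv ℝ (fun v => e (φ.symm v)) (φ x)) (φ x) :=
        ((hb.contDiffAt (hφ.open_target.mem_nhds (φ.map_source hxφ))).differentiableAt
          (by simp)).hasFDerivAt
      have h1 := (L.hasFDerivAt.comp (φ x) hd).congr_of_eventuallyEq (f₁ := id)
        (hLb.mono fun v hv => hv.symm)
      have h2 := h1.unique (hasFDerivAt_id _)
      exact Function.LeftInverse.injective (g := L) fun w => DFunLike.congr_fun h2 w
    obtain ⟨σ, P, Q, hP, hxP, hQ, hxQ, hσ, hcrit⟩ :=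
      exists_contDiffOn_eq_of_isLocalMin hφ.open_target hb (φ.map_source hxφ) hinj'
    simp only [hsymm] at hxP
    have hOQ : IsOpen (S.dom y ∩ φ ⁻¹' Q) := hφ.contMDiffOn.continuousOn.isOpen_inter_preimage
      hφ.isOpen hQ
    have hev : ∀ᶠ z in 𝓝 x, r z = φ.symm (σ (e z)) ∧ e z ∈ P ∧ σ (e z) ∈ φ.target := by
      filter_upwards [(hcont x hx).preimage_mem_nhds (hOQ.mem_nhds
        (by rw [hfix x hx]; exact ⟨hxy, hxQ⟩)),
        he.continuous.continuousAt.preimage_mem_nhds (hP.mem_nhds hxP)] with z hz hzP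
      have hzs : r z ∈ φ.source := by rw [hφ.source_eq]; exact ⟨hz.1, hrs z⟩
      have hzt := φ.map_source hzs
      have hm : IsLocalMin (fun w => ‖e z - e (φ.symm w)‖ ^ 2) (φ (r z)) := by
        filter_upwards [hφ.open_target.mem_nhds hzt] with w hw
        rw [φ.left_inv hzs]
        have := φ.map_target hw
        rw [hφ.source_eq] at this
        exact hr z _ this.2
      have := hcrit (e z) hzP (φ (r z)) hz.2 hm
      refine ⟨?_, hzP, ?_⟩
      · rw [← this, φ.left_inv hzs]
      · rwa [← this]
    filter_upwards [hev.eventually_nhds] with z hz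
    obtain ⟨-, hzP, hzt⟩ := hz.self_of_nhds
    have h1 : ContMDiffAt I (𝓡 d) ∞ (fun z => σ (e z)) z :=
      ((hσ.contMDiffOn _ hzP).contMDiffAt (hP.mem_nhds hzP)).comp z (he z)
    have h2 : ContMDiffAt (𝓡 d) I ∞ φ.symm (σ (e z)) :=
      (hφ.contMDiffOn_symm _ hzt).contMDiffAt (hφ.open_target.mem_nhds hzt)
    exact (h2.comp z h1).congr_of_eventuallyEq (hz.mono fun w hw => hw.1)
  refine ⟨r, interior {z | ContMDiffAt I I ∞ r z}, isOpen_interior,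
    fun x hx => mem_interior_iff_mem_nhds.2 (hsm x hx),
    fun z hz => ContMDiffAt.contMDiffWithinAt (interior_subset hz),
    fun z _ => hrs z, hfix⟩

end Retraction

/-! ### Ehresmann's theorem by means of a retraction onto the fibre. -/

section Ehresmann

variable {E : Type*} [NormedAddCommGroup E] [NormedSpace ℝ E]
  {H : Type*} [TopologicalSpace H] {I : ModelWithCorners ℝ E H} {M : Type u} [TopologicalSpace M]
  [ChartedSpace H M] {d : ℕ}
  {F : Type*} [NormedAddCommGroup F] [NormedSpace ℝ F] {F' : Type*} [NormedAddCommGroup F']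
  [NormedSpace ℝ F']
  {G : Type*} [TopologicalSpace G] {J : ModelWithCorners ℝ F' G} {N : Type*}

/-- A diffeomorphism from an open subset of `M` onto an open subset of the vector space `F`. -/
structure IsOpenChart (I : ModelWithCorners ℝ E H) (φ : PartialEquiv M F) : Prop where
  open_source : IsOpen φ.source
  open_target : IsOpen φ.target
  contMDiffOn : ContMDiffOn I 𝓘(ℝ, F) ∞ φ φ.source
  contMDiffOn_symm : ContMDiffOn 𝓘(ℝ, F) I ∞ φ.symm φ.target

/-- In the coordinates `κ` on `M` and `χ` on `N`, the map `f` is the projection to the first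
component. -/
structure IsAdaptedChart (I : ModelWithCorners ℝ E H) (f : M → N) (χ : PartialEquiv N F)
    (κ : PartialEquiv M (F × EuclideanSpace ℝ (Fin d))) : Prop extends IsOpenChart I κ where
  mem_source : ∀ y ∈ κ.source, f y ∈ χ.source
  fst_eq : ∀ y ∈ κ.source, (κ y).1 = χ (f y)

variable {f : M → N} {χ : PartialEquiv N F} {κ : PartialEquiv M (F × EuclideanSpace ℝ (Fin d))}
  {c : N}

theorem IsAdaptedChart.apply_symm_eq (h : IsAdaptedChart I f χ κ) (hc : c ∈ χ.source)
    {p : F × EuclideanSpace ℝ (Fin d)} (hp : p ∈ κ.target) (hpc : p.1 = χ c) :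
    f (κ.symm p) = c := by
  have hs := κ.map_target hp
  refine χ.injOn (h.mem_source _ hs) hc ?_
  rw [← h.fst_eq _ hs, κ.right_inv hp, hpc]

/-- The coordinates on the fibre given by an adapted chart. -/
def IsAdaptedChart.fibreChart (h : IsAdaptedChart I f χ κ) (hc : c ∈ χ.source) :
    PartialEquiv M (EuclideanSpace ℝ (Fin d)) where
  toFun y := (κ y).2
  invFun v := κ.symm (χ c, v)
  source := κ.source ∩ f ⁻¹' {c}
  target := {v | (χ c, v) ∈ κ.target}
  map_source' y hy := by
    have h1 : (χ c, (κ y).2) = κ y := Prod.ext (by rw [h.fst_eq y hy.1, hy.2]) rfl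
    change (χ c, (κ y).2) ∈ κ.target
    rw [h1]
    exact κ.map_source hy.1
  map_target' v hv := ⟨κ.map_target hv, h.apply_symm_eq hc hv rfl⟩
  left_inv' y hy := by
    have h1 : (χ c, (κ y).2) = κ y := Prod.ext (by rw [h.fst_eq y hy.1, hy.2]) rfl
    rw [h1]
    exact κ.left_inv hy.1
  right_inv' v hv := congrArg Prod.snd (κ.right_inv hv)

theorem IsAdaptedChart.isSlice (h : IsAdaptedChart I f χ κ) (hc : c ∈ χ.source) :
    IsSlice I (f ⁻¹' {c}) κ.source (h.fibreChart hc) where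
  isOpen := h.open_source
  source_eq := rfl
  open_target := h.open_target.preimage (by fun_prop : Continuous fun v => (χ c, v))
  contMDiffOn := contDiff_snd.contMDiff.comp_contMDiffOn h.contMDiffOn
  contMDiffOn_symm := h.contMDiffOn_symm.comp
    (contDiff_const.prodMk contDiff_id).contMDiff.contMDiffOn (fun _ hv => hv)

variable [TopologicalSpace N] [ChartedSpace G N]

/-- A smooth family of self-maps which is the identity at one parameter is locally invertible. -/
theorem exists_openPartialHomeomorph_fst_prodMk [FiniteDimensional ℝ E] [FiniteDimensional ℝ F]
    {k : F × E → E} {T : Set (F × E)} (hT : IsOpen T) (hk : ContDiffOn ℝ ∞ k T) {p : F × E}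
    (hp : p ∈ T) (hid : ∀ v, (p.1, v) ∈ T → k (p.1, v) = v) :
    ∃ e : OpenPartialHomeomorph (F × E) (F × E), p ∈ e.source ∧ e.source ⊆ T ∧
      (∀ x, e x = (x.1, k x)) ∧ ContDiffOn ℝ ∞ e.symm e.target := by
  have := FiniteDimensional.complete ℝ E
  have := FiniteDimensional.complete ℝ F
  have hd : HasFDerivAt k (fderiv ℝ k p) p :=
    ((hk.contDiffAt (hT.mem_nhds hp)).differentiableAt (by simp)).hasFDerivAt
  -- Since `k (p.1, ·)` is the identity near `p.2`, the derivative of `(z, v) ↦ (z, k (z, v))` is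
  -- block triangular with identity diagonal blocks.
  have hinr : ∀ w, fderiv ℝ k p (0, w) = w := fun w => by
    have h1 : HasFDerivAt (fun v => k (p.1, v)) ((fderiv ℝ k p).comp (.inr ℝ F E)) p.2 :=
      HasFDerivAt.comp p.2 (g := k) hd (hasFDerivAt_prodMk_right p.1 p.2)
    have hev : (fun v => k (p.1, v)) =ᶠ[𝓝 p.2] id := by
      have hc : ContinuousAt (fun v => (p.1, v)) p.2 := by fun_prop
      filter_upwards [hc.preimage_mem_nhds (hT.mem_nhds hp)] with v hv using hid v hv
    exact DFunLike.congr_fun (h1.unique ((hasFDerivAt_id p.2).congr_of_eventuallyEq hev)) w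
  let A : F × E →L[ℝ] F × E := (ContinuousLinearMap.fst ℝ F E).prod (fderiv ℝ k p)
  have hA : Function.Injective A := by
    rw [injective_iff_map_eq_zero]
    rintro ⟨z, w⟩ h
    have hz : z = 0 := congrArg Prod.fst h
    subst hz
    have hw : fderiv ℝ k p (0, w) = 0 := congrArg Prod.snd h
    rw [hinr] at hw
    rw [hw]
    rfl
  exact exists_openPartialHomeomorph_of_contDiffOn hT (contDiffOn_fst.prodMk hk) hp
    (LinearEquiv.ofInjectiveEndo (A : F × E →ₗ[ℝ] F × E) hA).toContinuousLinearEquiv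
    (hasFDerivAt_fst.prodMk hd)

variable [FiniteDimensional ℝ F]

/-- A map together with a retraction onto its fibre has smooth local inverses. -/
theorem exists_localInverse_of_retraction (hχ : IsOpenChart J χ) (hc : c ∈ χ.source)
    (S : SliceFamily I d (f ⁻¹' {c})) {r : M → M} {W : Set M} (hW : IsOpen W)
    (hr : ContMDiffOn I I ∞ r W) (hrW : MapsTo r W (f ⁻¹' {c})) (hfix : ∀ x ∈ f ⁻¹' {c}, r x = x)
    (hκ : IsAdaptedChart I f χ κ) {x₀ : M} (hx₀ : f x₀ = c) (hx₀W : x₀ ∈ W) (hx₀κ : x₀ ∈ κ.source) :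
    letI := S.chartedSpace
    ∃ (O : Set M) (Z : Set (N × (f ⁻¹' {c} : Set M))) (ι : N × (f ⁻¹' {c} : Set M) → M),
      IsOpen O ∧ x₀ ∈ O ∧ IsOpen Z ∧ (c, ⟨x₀, hx₀⟩) ∈ Z ∧
      ContMDiffOn (J.prod (𝓡 d)) I ∞ ι Z ∧
      (∀ p ∈ Z, ι p ∈ O ∧ f (ι p) = p.1 ∧ r (ι p) = p.2) ∧
      InjOn (fun y => (f y, r y)) O := by
  let _ := S.chartedSpace
  have := S.isManifold
  have hsl := hκ.isSlice hc
  set φ := hκ.fibreChart hc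
  -- In adapted coordinates `y ↦ (f y, r y)` becomes `q ↦ (q.1, k q)`. On the slice `q.1 = χ c` the
  -- map `k` is the second projection, because `r` fixes the fibre.
  let k : F × EuclideanSpace ℝ (Fin d) → EuclideanSpace ℝ (Fin d) := fun q => φ (r (κ.symm q))
  have hWr : IsOpen (W ∩ r ⁻¹' κ.source) :=
    hr.continuousOn.isOpen_inter_preimage hW hκ.open_source
  let T : Set (F × EuclideanSpace ℝ (Fin d)) := κ.target ∩ κ.symm ⁻¹' (W ∩ r ⁻¹' κ.source)
  have hT : IsOpen T := hκ.contMDiffOn_symm.continuousOn.isOpen_inter_preimage hκ.open_target hWr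
  have hk : ContDiffOn ℝ ∞ k T := by
    rw [← contMDiffOn_iff_contDiffOn]
    exact hsl.contMDiffOn.comp (hr.comp (hκ.contMDiffOn_symm.mono inter_subset_left)
      (fun q hq => hq.2.1)) (fun q hq => hq.2.2)
  have hsymm : κ.symm (κ x₀) = x₀ := κ.left_inv hx₀κ
  have hp : κ x₀ ∈ T := by
    refine ⟨κ.map_source hx₀κ, ?_⟩
    rw [mem_preimage, hsymm]
    exact ⟨hx₀W, by rwa [mem_preimage, hfix x₀ hx₀]⟩
  have hp1 : (κ x₀).1 = χ c := by rw [hκ.fst_eq x₀ hx₀κ, hx₀]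
  obtain ⟨e, hpe, heT, hev, hes⟩ := exists_openPartialHomeomorph_fst_prodMk hT hk hp (by
    intro v hv
    have hv' : f (κ.symm ((κ x₀).1, v)) = c := hκ.apply_symm_eq hc hv.1 hp1
    change (κ (r (κ.symm ((κ x₀).1, v)))).2 = v
    rw [hfix _ hv', κ.right_inv hv.1])
  let j : N × (f ⁻¹' {c} : Set M) → F × EuclideanSpace ℝ (Fin d) := fun p => (χ p.1, φ p.2)
  let Z₀ : Set (N × (f ⁻¹' {c} : Set M)) := χ.source ×ˢ (Subtype.val ⁻¹' κ.source)
  have hZ₀ : IsOpen Z₀ := hχ.open_source.prod (hκ.open_source.preimage continuous_subtype_val)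
  have hj : ContMDiffOn (J.prod (𝓡 d)) 𝓘(ℝ, F × EuclideanSpace ℝ (Fin d)) ∞ j Z₀ := by
    refine ContMDiffOn.prodMk_space ?_ ?_
    · exact hχ.contMDiffOn.comp contMDiffOn_fst (fun p hp => hp.1)
    · exact hsl.contMDiffOn.comp (S.contMDiff_coe.comp_contMDiffOn contMDiffOn_snd)
        (fun p hp => hp.2)
  have heκ : MapsTo e.symm e.target κ.target := fun q hq => (heT (e.map_target hq)).1
  refine ⟨κ.source ∩ κ ⁻¹' e.source, Z₀ ∩ j ⁻¹' e.target, fun p => κ.symm (e.symm (j p)),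
    hκ.contMDiffOn.continuousOn.isOpen_inter_preimage hκ.open_source e.open_source, ⟨hx₀κ, hpe⟩,
    hj.continuousOn.isOpen_inter_preimage hZ₀ e.open_target, ⟨⟨hc, hx₀κ⟩, ?_⟩, ?_, ?_, ?_⟩
  · have h1 := e.map_source hpe
    have h2 : e (κ x₀) = (χ c, φ x₀) := by
      rw [hev, hp1]
      change (χ c, φ (r (κ.symm (κ x₀)))) = _
      rw [hsymm, hfix x₀ hx₀]
    rwa [h2] at h1
  · exact hκ.contMDiffOn_symm.comp (hes.contMDiffOn.comp (hj.mono inter_subset_left)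
      (fun p hp => hp.2)) (fun p hp => heκ hp.2)
  · rintro ⟨n, y⟩ ⟨⟨hn, hy⟩, hq⟩
    have hs := e.map_target hq
    have hsT := heT hs
    have hks := κ.map_target hsT.1
    have h1 : e (e.symm (j (n, y))) = j (n, y) := e.right_inv hq
    rw [hev] at h1
    refine ⟨⟨hks, ?_⟩, ?_, ?_⟩
    · rwa [mem_preimage, κ.right_inv hsT.1]
    · refine χ.injOn (hκ.mem_source _ hks) hn ?_
      rw [← hκ.fst_eq _ hks, κ.right_inv hsT.1]
      exact congrArg Prod.fst h1
    · have h2 : φ (r (κ.symm (e.symm (j (n, y))))) = φ y := (congrArg Prod.snd h1 :)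
      refine φ.injOn ?_ ?_ h2
      · rw [hsl.source_eq]
        exact ⟨hsT.2.2, hrW hsT.2.1⟩
      · rw [hsl.source_eq]
        exact ⟨hy, y.2⟩
  · rintro y ⟨hy, hye⟩ y' ⟨hy', hye'⟩ heq
    have h1 : f y = f y' := congrArg Prod.fst heq
    have h2 : r y = r y' := congrArg Prod.snd heq
    refine κ.injOn hy hy' (e.injOn hye hye' ?_)
    rw [hev, hev]
    refine Prod.ext ?_ ?_
    · change (κ y).1 = (κ y').1
      rw [hκ.fst_eq y hy, hκ.fst_eq y' hy', h1]
    · change φ (r (κ.symm (κ y))) = φ (r (κ.symm (κ y')))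
      rw [κ.left_inv hy, κ.left_inv hy', h2]

/-- `Φ` trivializes `f` over the open set `U`, with typical fibre `Y`. -/
structure IsTrivialization (I : ModelWithCorners ℝ E H) (J : ModelWithCorners ℝ F' G) (f : M → N)
    {Y : Type*} [TopologicalSpace Y] [ChartedSpace (EuclideanSpace ℝ (Fin d)) Y] (U : Set N)
    (Φ : PartialEquiv M (N × Y)) : Prop where
  isOpen : IsOpen U
  source_eq : Φ.source = f ⁻¹' U
  target_eq : Φ.target = U ×ˢ univ
  contMDiffOn : ContMDiffOn I (J.prod (𝓡 d)) ∞ Φ Φ.source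
  contMDiffOn_symm : ContMDiffOn (J.prod (𝓡 d)) I ∞ Φ.symm Φ.target
  fst_eq : ∀ x ∈ Φ.source, (Φ x).1 = f x

/-- Ehresmann's fibration theorem: a proper submersion is trivial near a fibre. -/
theorem exists_isTrivialization [FiniteDimensional ℝ E] [T2Space M] [IsManifold I ∞ M] [T2Space N]
    (hf : ContMDiff I J ∞ f) (hfc : IsClosedMap f)
    (hcpt : IsCompact (f ⁻¹' {c})) (hne : (f ⁻¹' {c}).Nonempty)
    (hχ : IsOpenChart J χ) (hc : c ∈ χ.source)
    (hκ : ∀ x, f x = c → ∃ κ : PartialEquiv M (F × EuclideanSpace ℝ (Fin d)),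
      x ∈ κ.source ∧ IsAdaptedChart I f χ κ) :
    ∃ (Y : Type u) (_ : TopologicalSpace Y) (_ : ChartedSpace (EuclideanSpace ℝ (Fin d)) Y),
      IsManifold (𝓡 d) ∞ Y ∧ ∃ (U : Set N) (Φ : PartialEquiv M (N × Y)), c ∈ U ∧
        IsTrivialization (d := d) I J f U Φ := by
  have hκ' : ∀ x : (f ⁻¹' {c} : Set M), ∃ κ : PartialEquiv M (F × EuclideanSpace ℝ (Fin d)),
      (x : M) ∈ κ.source ∧ IsAdaptedChart I f χ κ := fun x => hκ x x.2
  choose κ hxκ hκ using hκ'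
  let S : SliceFamily I d (f ⁻¹' {c}) :=
    { dom := fun x => (κ x).source
      coord := fun x => (hκ x).fibreChart hc
      isSlice := fun x => (hκ x).isSlice hc
      mem_dom := hxκ }
  -- The typical fibre will be `f ⁻¹' {c}` itself, and `x ↦ (f x, r x)` the trivialization.
  obtain ⟨r, W, hW, hsW, hr, hrW, hfix⟩ := S.exists_retraction hcpt
  let _ := S.chartedSpace
  have := S.isManifold
  refine ⟨(f ⁻¹' {c} : Set M), inferInstance, inferInstance, this, ?_⟩
  have hloc : ∀ x : (f ⁻¹' {c} : Set M), _ := fun x =>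
    exists_localInverse_of_retraction hχ hc S hW hr hrW hfix (hκ x) x.2 (hsW x.2) (hxκ x)
  choose O Z ι hO hxO hZ hxZ hι hιp hinjO using hloc
  have hinj : InjOn (fun y => (f y, r y)) (f ⁻¹' {c}) := fun x hx y hy hxy => by
    have : r x = r y := congrArg Prod.snd hxy
    rwa [hfix x hx, hfix y hy] at this
  -- Injectivity on the compact fibre together with local injectivity at each of its points gives
  -- injectivity on a whole neighbourhood.
  obtain ⟨t₀, ht₀, hst₀, hinjt₀⟩ := hinj.exists_isOpen_superset hcpt
    (fun x hx => hf.continuous.continuousAt.prodMk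
      (hr.continuousOn.continuousAt (hW.mem_nhds (hsW hx))))
    (fun x hx => ⟨O ⟨x, hx⟩, (hO ⟨x, hx⟩).mem_nhds (hxO ⟨x, hx⟩), hinjO ⟨x, hx⟩⟩)
  let t := t₀ ∩ W
  have ht : IsOpen t := ht₀.inter hW
  have hst : f ⁻¹' {c} ⊆ t := fun x hx => ⟨hst₀ hx, hsW hx⟩
  have hinjt : InjOn (fun y => (f y, r y)) t := hinjt₀.mono inter_subset_left
  let Z' : (f ⁻¹' {c} : Set M) → Set (N × (f ⁻¹' {c} : Set M)) := fun x => Z x ∩ ι x ⁻¹' t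
  have hZ' : ∀ x, IsOpen (Z' x) := fun x =>
    (hι x).continuousOn.isOpen_inter_preimage (hZ x) ht
  have hxZ' : ∀ x, (c, x) ∈ Z' x := fun x => by
    refine ⟨hxZ x, ?_⟩
    obtain ⟨h1, h2, h3⟩ := hιp x _ (hxZ x)
    have : ι x (c, x) = x := hinjO x h1 (hxO x)
      (Prod.ext (h2.trans x.2.symm) (h3.trans (hfix x x.2).symm))
    rw [mem_preimage, this]
    exact hst x.2
  have : CompactSpace (f ⁻¹' {c} : Set M) := isCompact_iff_compactSpace.1 hcpt
  obtain ⟨U₁, B, hU₁, -, hcU₁, hB, hUB⟩ := generalized_tube_lemma (isCompact_singleton (x := c))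
    (isCompact_univ (X := (f ⁻¹' {c} : Set M))) (isOpen_iUnion hZ') (by
      rintro ⟨n, x⟩ ⟨hn, -⟩
      obtain rfl : n = c := hn
      exact mem_iUnion.2 ⟨x, hxZ' x⟩)
  have hU₂ : IsOpen (f '' tᶜ)ᶜ := (hfc _ ht.isClosed_compl).isOpen_compl
  -- The tube-lemma neighbourhood `U₁` ensures that every pair over it has a preimage in `t`;
  -- removing the closed set `f '' tᶜ` forces whole fibres into `t`, where `(f, r)` is injective.
  let U := U₁ ∩ (f '' tᶜ)ᶜ
  have hUt : f ⁻¹' U ⊆ t := fun x hx => by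
    by_contra hxt
    exact hx.2 ⟨x, hxt, rfl⟩
  have hex : ∀ p : N × (f ⁻¹' {c} : Set M), p.1 ∈ U →
      ∃ x, p ∈ Z' x ∧ f (ι x p) = p.1 ∧ r (ι x p) = p.2 := fun p hp => by
    obtain ⟨x, hx⟩ := mem_iUnion.1 (hUB (⟨hp.1, hB (mem_univ _)⟩ : p ∈ U₁ ×ˢ B))
    exact ⟨x, hx, (hιp x p hx.1).2⟩
  have x₀ : (f ⁻¹' {c} : Set M) := hne.to_subtype.some
  have : Nonempty (f ⁻¹' {c} : Set M) := ⟨x₀⟩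
  choose! w hwZ hwf hwr using hex
  classical
  let ρ : M → (f ⁻¹' {c} : Set M) := fun x => if h : f (r x) = c then ⟨r x, h⟩ else x₀
  have hρ : ∀ x ∈ W, (ρ x : M) = r x := fun x hx => by
    have : f (r x) = c := hrW hx
    simp [ρ, this]
  let Φ : PartialEquiv M (N × (f ⁻¹' {c} : Set M)) :=
    { toFun := fun x => (f x, ρ x)
      invFun := fun p => ι (w p) p
      source := f ⁻¹' U
      target := U ×ˢ univ
      map_source' := fun x hx => ⟨hx, mem_univ _⟩
      map_target' := fun p hp => by rw [mem_preimage, hwf p hp.1]; exact hp.1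
      left_inv' := fun x hx => by
        have hx' : f x ∈ U := hx
        refine hinjt (hwZ (f x, ρ x) hx').2 (hUt hx) (Prod.ext (hwf (f x, ρ x) hx') ?_)
        exact (hwr (f x, ρ x) hx').trans (hρ x (hUt hx).2)
      right_inv' := fun p hp => by
        refine Prod.ext (hwf p hp.1) (Subtype.ext ?_)
        rw [hρ _ (hwZ p hp.1).2.2]
        exact hwr p hp.1 }
  refine ⟨U, Φ, ⟨hcU₁ rfl, ?_⟩, ⟨hU₁.inter hU₂, rfl, rfl, ?_, ?_, fun x _ => rfl⟩⟩
  · rintro ⟨x, hx, hxc⟩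
    exact hx (hst hxc)
  · intro x hx
    have hxW : x ∈ W := (hUt hx).2
    have h1 : ContMDiffAt I (𝓡 d) ∞ ρ x := by
      refine S.contMDiffAt_of_coe (((hr x hxW).contMDiffAt
        (hW.mem_nhds hxW)).congr_of_eventuallyEq ?_)
      filter_upwards [hW.mem_nhds hxW] with y hy using hρ y hy
    exact (ContMDiffAt.prodMk (hf x) h1).contMDiffWithinAt
  · intro p hp
    have hpZ := hwZ p hp.1
    have h1 : ContMDiffAt (J.prod (𝓡 d)) I ∞ (ι (w p)) p :=
      (hι (w p) p hpZ.1).contMDiffAt ((hZ (w p)).mem_nhds hpZ.1)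
    -- The index `w q` varies with `q` without any continuity, but injectivity on `t` identifies `ι
    -- (w q) q` with `ι (w p) q` near `p`.
    refine (h1.congr_of_eventuallyEq ?_).contMDiffWithinAt
    have hU : IsOpen (U ×ˢ univ : Set (N × (f ⁻¹' {c} : Set M))) :=
      (hU₁.inter hU₂).prod isOpen_univ
    filter_upwards [(hZ' (w p)).mem_nhds hpZ, hU.mem_nhds hp] with q hq hqU
    obtain ⟨-, h2, h3⟩ := hιp (w p) q hq.1
    exact hinjt (hwZ q hqU.1).2 hq.2
      (Prod.ext ((hwf q hqU.1).trans h2.symm) ((hwr q hqU.1).trans h3.symm))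

end Ehresmann

/-! ### Comparison of typical fibres over a connected base. -/

section FibreBundle

variable {E : Type*} [NormedAddCommGroup E] [NormedSpace ℝ E]
  {H : Type*} [TopologicalSpace H] {I : ModelWithCorners ℝ E H} {M : Type u} [TopologicalSpace M]
  [ChartedSpace H M] {d : ℕ} {F : Type*} [NormedAddCommGroup F] [NormedSpace ℝ F]
  {G : Type*} [TopologicalSpace G] {J : ModelWithCorners ℝ F G} {N : Type*} [TopologicalSpace N]
  [ChartedSpace G N] {f : M → N}
  {Y : Type*} [TopologicalSpace Y] [ChartedSpace (EuclideanSpace ℝ (Fin d)) Y]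
  {Y' : Type*} [TopologicalSpace Y'] [ChartedSpace (EuclideanSpace ℝ (Fin d)) Y']
  {U U' : Set N} {Φ : PartialEquiv M (N × Y)} {Φ' : PartialEquiv M (N × Y')} {c : N}

namespace IsTrivialization

theorem mem_target (h : IsTrivialization (d := d) I J f U Φ) (hc : c ∈ U) (y : Y) :
    (c, y) ∈ Φ.target := by
  rw [h.target_eq]
  exact ⟨hc, mem_univ _⟩

theorem mem_source (h : IsTrivialization (d := d) I J f U Φ) {x : M} (hx : f x ∈ U) :
    x ∈ Φ.source := by
  rw [h.source_eq]
  exact hx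

theorem apply_symm (h : IsTrivialization (d := d) I J f U Φ) (hc : c ∈ U) (y : Y) :
    f (Φ.symm (c, y)) = c := by
  rw [← h.fst_eq _ (Φ.map_target (h.mem_target hc y)), Φ.right_inv (h.mem_target hc y)]

theorem mono (h : IsTrivialization (d := d) I J f U Φ) (hU' : IsOpen U') (hUU' : U' ⊆ U) :
    ∃ Φ₁ : PartialEquiv M (N × Y), IsTrivialization (d := d) I J f U' Φ₁ := by
  refine ⟨⟨Φ, Φ.symm, f ⁻¹' U', U' ×ˢ univ, fun x hx => ⟨?_, mem_univ _⟩, fun p hp => ?_,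
    fun x hx => Φ.left_inv (h.mem_source (hUU' hx)),
    fun p hp => Φ.right_inv (h.mem_target (hUU' hp.1) p.2)⟩, ⟨hU', rfl, rfl, ?_, ?_, ?_⟩⟩
  · rw [h.fst_eq x (h.mem_source (hUU' hx))]
    exact hx
  · rw [mem_preimage, h.apply_symm (hUU' hp.1) p.2]
    exact hp.1
  · exact h.contMDiffOn.mono fun x hx => h.mem_source (hUU' hx)
  · exact h.contMDiffOn_symm.mono fun p hp => h.mem_target (hUU' hp.1) p.2
  · exact fun x hx => h.fst_eq x (h.mem_source (hUU' hx))

/-- Both typical fibres are copies of the fibre over the common point `c`. Exchanging the two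
trivializations gives the inverse map, by `transfer_transfer`. -/
theorem contMDiff_transfer (h : IsTrivialization (d := d) I J f U Φ)
    (h' : IsTrivialization (d := d) I J f U' Φ') (hc : c ∈ U) (hc' : c ∈ U') :
    ContMDiff (𝓡 d) (𝓡 d) ∞ (fun y => (Φ' (Φ.symm (c, y))).2) := by
  rw [← contMDiffOn_univ]
  have h1 : ContMDiffOn (𝓡 d) I ∞ (fun y => Φ.symm (c, y)) univ :=
    h.contMDiffOn_symm.comp (contMDiff_const.prodMk contMDiff_id).contMDiffOn
      (fun y _ => h.mem_target hc y)
  refine contMDiff_snd.comp_contMDiffOn (h'.contMDiffOn.comp h1 fun y _ => h'.mem_source ?_)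
  rwa [h.apply_symm hc]

theorem transfer_transfer (h : IsTrivialization (d := d) I J f U Φ)
    (h' : IsTrivialization (d := d) I J f U' Φ') (hc : c ∈ U) (hc' : c ∈ U') (y : Y) :
    (Φ (Φ'.symm (c, (Φ' (Φ.symm (c, y))).2))).2 = y := by
  have hs : Φ.symm (c, y) ∈ Φ'.source := h'.mem_source (by rwa [h.apply_symm hc])
  have h1 : (c, (Φ' (Φ.symm (c, y))).2) = Φ' (Φ.symm (c, y)) :=
    Prod.ext (by rw [h'.fst_eq _ hs, h.apply_symm hc]) rfl
  rw [h1, Φ'.left_inv hs, Φ.right_inv (h.mem_target hc y)]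

/-- The typical fibres of two overlapping trivializations are diffeomorphic. -/
theorem exists_of_inter (h : IsTrivialization (d := d) I J f U Φ)
    (h' : IsTrivialization (d := d) I J f U' Φ') (hc : c ∈ U) (hc' : c ∈ U') :
    ∃ Φ₁ : PartialEquiv M (N × Y'), IsTrivialization (d := d) I J f U Φ₁ := by
  have hα := h.contMDiff_transfer h' hc hc'
  have hβ := h'.contMDiff_transfer h hc' hc
  have hβα := h.transfer_transfer h' hc hc'
  have hαβ := h'.transfer_transfer h hc' hc
  refine ⟨⟨fun x => ((Φ x).1, (Φ' (Φ.symm (c, (Φ x).2))).2),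
    fun p => Φ.symm (p.1, (Φ (Φ'.symm (c, p.2))).2), f ⁻¹' U, U ×ˢ univ, ?_, ?_, ?_, ?_⟩,
    ⟨h.isOpen, rfl, rfl, ?_, ?_, fun x hx => h.fst_eq x (h.mem_source hx)⟩⟩
  · intro x hx
    refine ⟨?_, mem_univ _⟩
    rw [h.fst_eq x (h.mem_source hx)]
    exact hx
  · intro p hp
    rw [mem_preimage, h.apply_symm hp.1]
    exact hp.1
  · intro x hx
    simp only [hβα, Prod.mk.eta]
    exact Φ.left_inv (h.mem_source hx)
  · intro p hp
    simp only [Φ.right_inv (h.mem_target hp.1 _), hαβ]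
  · have h1 : ContMDiffOn I (J.prod (𝓡 d)) ∞ Φ (f ⁻¹' U) := h.source_eq ▸ h.contMDiffOn
    exact (contMDiff_fst.comp_contMDiffOn h1).prodMk
      (hα.comp_contMDiffOn (contMDiff_snd.comp_contMDiffOn h1))
  · exact h.contMDiffOn_symm.comp
      (contMDiff_fst.prodMk (hβ.comp contMDiff_snd)).contMDiffOn
      (fun p hp => h.mem_target hp.1 _)

end IsTrivialization

/-- A locally trivial map is a fibre bundle over every connected open set. -/
theorem isFibreBundleOver_of_isPreconnected {S : Set N} (hS : IsOpen S) (hne : S.Nonempty)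
    (hconn : IsPreconnected S)
    (h : ∀ c ∈ S, ∃ (Y : Type u) (_ : TopologicalSpace Y)
      (_ : ChartedSpace (EuclideanSpace ℝ (Fin d)) Y),
      IsManifold (𝓡 d) ∞ Y ∧ ∃ (U : Set N) (Φ : PartialEquiv M (N × Y)), c ∈ U ∧
        IsTrivialization (d := d) I J f U Φ) :
    IsFibreBundleOver d I J f S := by
  obtain ⟨c₀, hc₀⟩ := hne
  obtain ⟨Y, hYt, hYc, hY, U₀, Φ₀, hcU₀, hΦ₀⟩ := h c₀ hc₀
  -- A connectedness argument: `A` consists of the points having a trivialization with fibre `Y`. A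
  -- trivialization whose domain meets `A` can be given fibre `Y`, so every point of `S` lies in `A`
  -- or has a neighbourhood disjoint from `A`.
  let A : Set N := {c | ∃ (U : Set N) (Φ : PartialEquiv M (N × Y)), c ∈ U ∧
    IsTrivialization (d := d) I J f U Φ}
  let B : Set N := ⋃₀ {V | IsOpen V ∧ Disjoint V A}
  have hA : IsOpen A := isOpen_iff_forall_mem_open.2 fun c ⟨U, Φ, hc, hΦ⟩ =>
    ⟨U, fun c' hc' => ⟨U, Φ, hc', hΦ⟩, hΦ.isOpen, hc⟩
  have hB : IsOpen B := isOpen_sUnion fun V hV => hV.1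
  have hAB : Disjoint B A := disjoint_sUnion_left.2 fun V hV => hV.2
  have hcov : S ⊆ A ∪ B := fun c hc => by
    obtain ⟨Y', _, _, -, U, Φ, hcU, hΦ⟩ := h c hc
    by_cases hd : Disjoint U A
    · exact Or.inr ⟨U, ⟨hΦ.isOpen, hd⟩, hcU⟩
    · obtain ⟨c', hc'U, U', Φ', hc'U', hΦ'⟩ := not_disjoint_iff.1 hd
      obtain ⟨Φ₁, hΦ₁⟩ := hΦ.exists_of_inter hΦ' hc'U hc'U'
      exact Or.inl ⟨U, Φ₁, hcU, hΦ₁⟩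
  have hSA : S ⊆ A := hconn.subset_left_of_subset_union hA hB hAB.symm hcov
    ⟨c₀, hc₀, U₀, Φ₀, hcU₀, hΦ₀⟩
  refine ⟨Y, hYt, hYc, hY, fun c hc => ?_⟩
  obtain ⟨U, Φ, hcU, hΦ⟩ := hSA hc
  obtain ⟨Φ₁, hΦ₁⟩ := hΦ.mono (hΦ.isOpen.inter hS) inter_subset_left
  exact ⟨U ∩ S, Φ₁, hΦ₁.isOpen, ⟨hcU, hc⟩, inter_subset_right, hΦ₁.source_eq, hΦ₁.target_eq,
    hΦ₁.contMDiffOn, hΦ₁.contMDiffOn_symm, hΦ₁.fst_eq⟩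

end FibreBundle

/-! ### Density and connectedness from local traces. -/

section Connected

variable {C : Type*} [TopologicalSpace C] {A : Set C}

theorem dense_of_locally_subset_closure
    (h : ∀ c, ∃ N ∈ 𝓝 c, ∃ T ⊆ A, IsPreconnected T ∧ N ⊆ closure T) : Dense A := fun c => by
  obtain ⟨N, hN, T, hTA, -, hNT⟩ := h c
  exact closure_mono hTA (hNT (mem_of_mem_nhds hN))

/-- A subset of a connected space whose trace near every point is, up to closure, connected is
connected. -/
theorem isPreconnected_of_locally_subset_closure [PreconnectedSpace C]
    (h : ∀ c, ∃ N ∈ 𝓝 c, ∃ T ⊆ A, IsPreconnected T ∧ N ⊆ closure T) : IsPreconnected A := by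
  rw [isPreconnected_iff_subset_of_disjoint]
  intro U V hU hV hAUV hd
  -- Each connected trace `T` lies in `U` or in `V`, so `P U` and `P V` cover `C`. They are open,
  -- and disjoint because two traces dense near the same point would produce a point of `A ∩ (U ∩
  -- V)`. Hence one of them is all of `C`.
  let P : Set C → Set C := fun W => {c | ∃ N ∈ 𝓝 c, ∃ T ⊆ A ∩ W, N ⊆ closure T}
  have hPo : ∀ W, IsOpen (P W) := fun W => isOpen_iff_mem_nhds.2 fun c ⟨N, hN, T, hT, hNT⟩ => by
    filter_upwards [eventually_mem_nhds_iff.2 hN] with c' hc'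
    exact ⟨N, hc', T, hT, hNT⟩
  have hcov : univ ⊆ P U ∪ P V := fun c _ => by
    obtain ⟨N, hN, T, hTA, hT, hNT⟩ := h c
    have hTd : T ∩ (U ∩ V) = ∅ := subset_empty_iff.1
      ((inter_subset_inter_left _ hTA).trans hd.subset)
    rcases (isPreconnected_iff_subset_of_disjoint.1 hT) U V hU hV (hTA.trans hAUV) hTd with h1 | h1
    · exact Or.inl ⟨N, hN, T, subset_inter hTA h1, hNT⟩
    · exact Or.inr ⟨N, hN, T, subset_inter hTA h1, hNT⟩
  have hdis : ∀ c, c ∈ P U → c ∉ P V := by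
    rintro c ⟨N, hN, T, hT, hNT⟩ ⟨N', hN', T', hT', hNT'⟩
    obtain ⟨t, htN', htT⟩ := mem_closure_iff_nhds.1 (hNT (mem_of_mem_nhds hN)) N' hN'
    obtain ⟨t', ht'U, ht'T'⟩ := mem_closure_iff_nhds.1 (hNT' htN') U (hU.mem_nhds (hT htT).2)
    exact hd.subset ⟨(hT' ht'T').1, ht'U, (hT' ht'T').2⟩
  have key : ∀ W W', IsOpen W' → A ⊆ W ∪ W' → A ∩ (W ∩ W') = ∅ → univ ⊆ P W → A ⊆ W := by
    intro W W' hW' hA hWW' hPW a ha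
    rcases hA ha with h1 | h1
    · exact h1
    obtain ⟨N, hN, T, hT, hNT⟩ := hPW (mem_univ a)
    obtain ⟨t, htW', htT⟩ := mem_closure_iff_nhds.1 (hNT (mem_of_mem_nhds hN)) W' (hW'.mem_nhds h1)
    exact (hWW'.subset ⟨(hT htT).1, (hT htT).2, htW'⟩).elim
  rcases isPreconnected_iff_subset_of_disjoint.1 isPreconnected_univ (P U) (P V) (hPo U) (hPo V)
    hcov (by rw [univ_inter]; exact eq_empty_of_forall_notMem fun c hc => hdis c hc.1 hc.2)
    with h1 | h1
  · exact Or.inl (key U V hV hAUV hd h1)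
  · exact Or.inr (key V U hU (by rwa [union_comm]) (by rwa [inter_comm V U]) h1)

end Connected

/-! ### From holomorphic to real differential calculus. -/

section RealModel

variable {E : Type*} [NormedAddCommGroup E] [NormedSpace ℂ E] {H : Type*} [TopologicalSpace H]
  {I : ModelWithCorners ℂ E H} {M : Type*} [TopologicalSpace M] [ChartedSpace H M]
  {E' : Type*} [NormedAddCommGroup E'] [NormedSpace ℂ E'] {H' : Type*} [TopologicalSpace H']
  {I' : ModelWithCorners ℂ E' H'} {M' : Type*} [TopologicalSpace M'] [ChartedSpace H' M']
  {f : M → M'} {s : Set M} {x : M}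

theorem _root_.ContMDiffWithinAt.real (h : ContMDiffWithinAt I I' ∞ f s x) :
    ContMDiffWithinAt (realModel I) (realModel I') ∞ f s x := by
  rw [contMDiffWithinAt_iff] at h ⊢
  exact ⟨h.1, h.2.restrict_scalars ℝ⟩

theorem _root_.ContMDiffOn.real (h : ContMDiffOn I I' ∞ f s) :
    ContMDiffOn (realModel I) (realModel I') ∞ f s := fun x hx => (h x hx).real

theorem _root_.ContMDiff.real (h : ContMDiff I I' ∞ f) :
    ContMDiff (realModel I) (realModel I') ∞ f := fun x => ContMDiffWithinAt.real (h x)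

theorem _root_.MDifferentiableWithinAt.real (h : MDifferentiableWithinAt I I' f s x) :
    MDifferentiableWithinAt (realModel I) (realModel I') f s x := by
  rw [mdifferentiableWithinAt_iff'] at h ⊢
  exact ⟨h.1, h.2.restrictScalars ℝ⟩

/-- Both models have the same charts, and a complex derivative with scalars restricted is the unique
real derivative. -/
theorem mfderivWithin_realModel (h : MDifferentiableWithinAt I I' f s x)
    (hs : UniqueMDiffWithinAt (realModel I) s x) (v : E) :
    (mfderivWithin (realModel I) (realModel I') f s x : E → E') v =
      (mfderivWithin I I' f s x : E → E') v := by
  have h1 := h.real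
  rw [h1.mfderivWithin, h.mfderivWithin]
  have h2 := (mdifferentiableWithinAt_iff' f s x).1 h
  exact (DFunLike.congr_fun (h2.2.restrictScalars_fderivWithin ℝ hs) v).symm

theorem mfderiv_realModel (h : MDifferentiableAt I I' f x) (v : E) :
    (mfderiv (realModel I) (realModel I') f x : E → E') v = (mfderiv I I' f x : E → E') v := by
  rw [← mfderivWithin_univ, ← mfderivWithin_univ]
  exact mfderivWithin_realModel h (uniqueMDiffWithinAt_univ _) v

theorem isCriticalPoint_realModel (h : MDifferentiableAt I I' f x) :
    IsCriticalPoint (realModel I) (realModel I') f x ↔ IsCriticalPoint I I' f x := by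
  have : (mfderiv (realModel I) (realModel I') f x : E → E') = (mfderiv I I' f x : E → E') :=
    funext fun v : E => mfderiv_realModel h v
  exact not_congr (by unfold Function.Surjective; exact iff_of_eq (congrArg
    (fun g : E → E' => ∀ b, ∃ a, g a = b) this))

end RealModel

/-! ### The real part of a holomorphic symplectic form. -/

section Symplectic

variable {E : Type*} [NormedAddCommGroup E] [NormedSpace ℂ E] {H : Type*} [TopologicalSpace H]
  {I : ModelWithCorners ℂ E H} {X : Type*} [TopologicalSpace X] [ChartedSpace H X]

section TwoForms

variable {𝕜 : Type*} [NontriviallyNormedField 𝕜] {W : Type*} [NormedAddCommGroup W]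
  [NormedSpace 𝕜 W] (σ : W [⋀^Fin 2]→L[𝕜] 𝕜)

theorem map_smul_right (a : 𝕜) (v w : W) : σ ![v, a • w] = a • σ ![v, w] := by
  have h : ∀ u : W, Function.update ![v, 0] 1 u = ![v, u] := fun u => by
    ext i
    fin_cases i <;> rfl
  have := σ.map_update_smul ![v, 0] 1 a w
  rwa [h, h] at this

theorem map_add_right (v w w' : W) : σ ![v, w + w'] = σ ![v, w] + σ ![v, w'] := by
  have h : ∀ u : W, Function.update ![v, 0] 1 u = ![v, u] := fun u => by
    ext i
    fin_cases i <;> rfl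
  have := σ.map_update_add ![v, 0] 1 w w'
  rwa [h, h, h] at this

theorem map_self_self (v : W) : σ ![v, v] = 0 :=
  σ.map_eq_zero_of_eq ![v, v] (i := 0) (j := 1) rfl (by simp)

theorem map_swap (v w : W) : σ ![w, v] = -σ ![v, w] := by
  have h := σ.map_swap ![v, w] (i := 0) (j := 1) (by simp)
  refine Eq.trans ?_ h
  change σ _ = σ _
  congr 1
  ext i
  fin_cases i <;> rfl

end TwoForms

/-- The real part of an alternating form, as a continuous linear map. -/
def rePartL : (E [⋀^Fin 2]→L[ℂ] ℂ) →L[ℝ] E [⋀^Fin 2]→L[ℝ] ℝ :=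
  (ContinuousLinearMap.compContinuousAlternatingMapCLM ℝ E ℂ ℝ (Fin 2) Complex.reCLM).comp
    (ContinuousAlternatingMap.restrictScalarsLI (𝕜 := ℂ) (𝕜' := ℝ) (E := E) (F := ℂ)
      (ι := Fin 2)).toContinuousLinearMap

theorem TwoForm.re_inChart [IsManifold I ∞ X] (Ω : TwoForm I X) (x₀ : X) {y : E}
    (hy : y ∈ (extChartAt I x₀).target) :
    (Ω.re I).inChart (realModel I) x₀ y = rePart (Ω.inChart I x₀ y) := by
  ext v
  have hd : MDifferentiableWithinAt 𝓘(ℂ, E) I (extChartAt I x₀).symm (range I) y :=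
    ((contMDiffWithinAt_extChartAt_symm_range x₀ hy).mdifferentiableWithinAt
      (by simp : (∞ : WithTop ℕ∞) ≠ 0))
  have hs : UniqueMDiffWithinAt (realModel 𝓘(ℂ, E)) (range I) y :=
    ((realModel I).uniqueDiffOn y (extChartAt_target_subset_range x₀ hy)).uniqueMDiffWithinAt
  have h1 := fun w : E => mfderivWithin_realModel hd hs w
  change (Ω ((extChartAt I x₀).symm y) _).re = (Ω ((extChartAt I x₀).symm y) _).re
  congr 2
  funext i
  exact h1 (v i)

/-- Smoothness and closedness pass through the continuous real-linear map `rePartL`. If `Re Ω(v, ·)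
= 0`, then evaluating at `i w` kills the imaginary part of `Ω(v, w)` too. -/
theorem IsSymplecticForm.re [IsManifold I ∞ X] {Ω : TwoForm I X} (h : IsSymplecticForm I Ω) :
    IsSymplecticForm (realModel I) (Ω.re I) where
  smooth x₀ := by
    have h1 := ((h.smooth x₀).restrict_scalars ℝ)
    exact ((rePartL (E := E)).contDiff.comp_contDiffOn h1).congr
      fun y hy => TwoForm.re_inChart Ω x₀ hy
  closed x₀ y hy := by
    have hyr : y ∈ range I := extChartAt_target_subset_range x₀ hy
    have ht : (extChartAt I x₀).target ∈ 𝓝[range I] y := extChartAt_target_mem_nhdsWithin_of_mem hy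
    have hd : DifferentiableWithinAt ℂ (Ω.inChart I x₀) (range I) y :=
      (((h.smooth x₀) y hy).differentiableWithinAt (by simp)).mono_of_mem_nhdsWithin ht
    have hu : UniqueDiffWithinAt ℝ (range I) y := (realModel I).uniqueDiffOn y hyr
    have hd' : HasFDerivWithinAt ((Ω.re I).inChart (realModel I) x₀)
        ((rePartL (E := E)).comp ((fderivWithin ℂ (Ω.inChart I x₀) (range I) y).restrictScalars ℝ))
        (range I) y := by
      refine HasFDerivWithinAt.congr_of_eventuallyEq
        ((rePartL (E := E)).hasFDerivAt.comp_hasFDerivWithinAt y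
          (hd.hasFDerivWithinAt.restrictScalars ℝ)) ?_ (TwoForm.re_inChart Ω x₀ hy)
      filter_upwards [ht] with z hz using TwoForm.re_inChart Ω x₀ hz
    ext v
    have h0 := DFunLike.congr_fun (h.closed x₀ y hy) v
    change extDerivWithin ((Ω.re I).inChart (realModel I) x₀) (range I) y v = 0
    rw [extDerivWithin, ContinuousAlternatingMap.alternatizeUncurryFin_apply] at h0 ⊢
    rw [hd'.fderivWithin hu]
    have h1 := congrArg Complex.re h0
    rw [Complex.re_sum] at h1
    convert h1 using 2 with i
    · rw [← Int.cast_smul_eq_zsmul ℝ, ← Int.cast_smul_eq_zsmul ℝ, Complex.smul_re]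
      rfl
    · rfl
  nondegenerate x v hv := by
    refine h.nondegenerate x v fun w => ?_
    have hre : ∀ w : E, (Ω x ![v, w]).re = 0 := fun w => hv w
    refine Complex.ext (hre w) ?_
    have h1 := hre (Complex.I • (w : E))
    have h2 := map_smul_right (W := E) (Ω x) Complex.I v w
    have h3 := (congrArg Complex.re h2).symm.trans h1
    rw [smul_eq_mul, Complex.I_mul_re] at h3
    exact neg_eq_zero.1 h3

end Symplectic

/-! ### Regular fibres are Lagrangian. -/

section Lagrangian

variable {E : Type*} [NormedAddCommGroup E] [NormedSpace ℂ E] {H : Type*} [TopologicalSpace H]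
  {I : ModelWithCorners ℂ E H} {X : Type*} [TopologicalSpace X] [ChartedSpace H X]
  {HC : Type*} [TopologicalSpace HC] {IC : ModelWithCorners ℂ ℂ HC}
  {C : Type*} [TopologicalSpace C] [ChartedSpace HC C]

/-- A line in a complex symplectic plane is Lagrangian for the real part of the form. -/
theorem mem_ker_iff_forall_re_eq_zero (hE : Module.finrank ℂ E = 2) (σ : E [⋀^Fin 2]→L[ℂ] ℂ)
    (hσ : ∀ v : E, (∀ w : E, σ ![v, w] = 0) → v = 0) (L : E →L[ℂ] ℂ)
    (hL : Function.Surjective L) (v : E) :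
    L v = 0 ↔ ∀ w : E, L w = 0 → (σ ![v, w]).re = 0 := by
  have : FiniteDimensional ℂ E := .of_finrank_pos (by omega)
  have hker : Module.finrank ℂ (LinearMap.ker (L : E →ₗ[ℂ] ℂ)) = 1 := by
    have h1 := LinearMap.finrank_range_add_finrank_ker (L : E →ₗ[ℂ] ℂ)
    have h2 : LinearMap.range (L : E →ₗ[ℂ] ℂ) = ⊤ := LinearMap.range_eq_top.2 hL
    rw [h2, finrank_top, Module.finrank_self, hE] at h1
    omega
  obtain ⟨⟨k, hk⟩, hk0, hspan⟩ := finrank_eq_one_iff'.1 hker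
  have hk' : L k = 0 := hk
  have hk0' : k ≠ 0 := fun h => hk0 (Subtype.ext h)
  have hspan' : ∀ w : E, L w = 0 → ∃ a : ℂ, a • k = w := fun w hw => by
    obtain ⟨a, ha⟩ := hspan ⟨w, hw⟩
    exact ⟨a, congrArg Subtype.val ha⟩
  constructor
  · intro hv w hw
    obtain ⟨a, rfl⟩ := hspan' v hv
    obtain ⟨b, rfl⟩ := hspan' w hw
    rw [map_smul_right, map_swap, map_smul_right, map_self_self]
    simp
  · intro h
    -- Testing against `k` and `i k` gives the full complex equation `σ(v, k) = 0`. If `L v ≠ 0`,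
    -- then `v` and `k` span `E`, so `k` would lie in the radical of `σ`.
    have hvk : σ ![v, k] = 0 := by
      refine Complex.ext (h k hk') ?_
      have h1 := h (Complex.I • k) (by rw [map_smul, hk', smul_zero])
      rw [map_smul_right, smul_eq_mul, Complex.I_mul_re] at h1
      exact neg_eq_zero.1 h1
    by_contra hv
    refine hk0' (hσ k fun w => ?_)
    obtain ⟨a, ha⟩ := hspan' (w - (L w / L v) • v) (by
      rw [map_sub, map_smul, smul_eq_mul, div_mul_cancel₀ _ hv, sub_self])
    have hw : w = a • k + (L w / L v) • v := by rw [ha]; abel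
    rw [hw, map_add_right, map_smul_right, map_smul_right, map_self_self, map_swap, hvk]
    simp

theorem isLagrangianFibre_re [IsManifold I ∞ X] (hE : Module.finrank ℂ E = 2) {Ω : TwoForm I X}
    (hΩ : IsSymplecticForm I Ω) {π : X → C} (hπ : ContMDiff I IC ∞ π) {c : C}
    (hc : IsRegularValue (realModel I) (realModel IC) π c) :
    IsLagrangianFibre (realModel I) (realModel IC) (Ω.re I) π c := by
  intro x hx
  have hd : MDifferentiableAt I IC π x := (hπ x).mdifferentiableAt (by simp)
  have hcrit := hc x hx
  have hs : Function.Surjective (mfderiv I IC π x) := by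
    by_contra h
    exact hcrit ((isCriticalPoint_realModel hd).2 h)
  refine ⟨hcrit, fun v => ?_⟩
  have h := mem_ker_iff_forall_re_eq_zero hE (Ω x) (hΩ.nondegenerate x) (mfderiv I IC π x) hs v
  have hr := fun w : E => mfderiv_realModel hd w
  constructor
  · intro hv w hw
    exact h.1 ((hr v).symm.trans hv) w ((hr w).symm.trans hw)
  · intro hv
    exact (hr v).trans (h.2 fun w hw => hv w ((hr w).trans hw))

end Lagrangian

/-! ### Isolation of critical points and critical values. -/

section Critical

variable {E : Type*} [NormedAddCommGroup E] [NormedSpace ℂ E] {H : Type*} [TopologicalSpace H]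
  {I : ModelWithCorners ℂ E H} {X : Type*} [TopologicalSpace X] [ChartedSpace H X]
  {HC : Type*} [TopologicalSpace HC] {IC : ModelWithCorners ℂ ℂ HC}
  {C : Type*} [TopologicalSpace C] [ChartedSpace HC C]
  {V : Type*} [NormedAddCommGroup V] [NormedSpace ℂ V]

/-- The base has complex dimension one, and a linear functional that is not onto is zero. -/
theorem mfderiv_eq_zero_of_isCriticalPoint {π : X → C} {q : X} (h : IsCriticalPoint I IC π q)
    (v : E) : (mfderiv I IC π q : E →L[ℂ] ℂ) v = 0 := by
  let L : E →L[ℂ] ℂ := mfderiv I IC π q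
  by_contra hv
  refine h fun (a : ℂ) => ⟨((a / L v) • v : E), ?_⟩
  change L _ = _
  rw [map_smul, smul_eq_mul, div_mul_cancel₀ _ hv]

theorem IsLocalChart.mdifferentiableAt {φ : PartialEquiv X V} (h : IsLocalChart I φ) {q : X}
    (hq : q ∈ φ.source) : MDifferentiableAt I 𝓘(ℂ, V) φ q :=
  ((h.contMDiffOn q hq).contMDiffAt (h.open_source.mem_nhds hq)).mdifferentiableAt (by simp)

/-- The critical points of a Lefschetz fibration are isolated. -/
theorem exists_mem_nhds_forall_isCriticalPoint_eq {n : ℕ} {Ω : TwoForm I X}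
    (hE : Module.finrank ℂ E = 2 * n)
    (hΩ : IsSymplecticForm I Ω) {π : X → C} (hπ : ContMDiff I IC ∞ π) {p : X}
    (hp : IsCriticalPoint I IC π p) (h : HasMorseDarbouxCharts n I IC Ω π p) :
    ∃ W ∈ 𝓝 p, ∀ q ∈ W, IsCriticalPoint I IC π q → q = p := by
  obtain ⟨z, ψ, hz, hψ, hpz, hmaps, hform, hsq⟩ := h
  -- Where `dπ = 0`, differentiating `ψ ∘ π = ∑ z_i²` gives `∑ z_i dz_i = 0`. Since `Ω` is written
  -- in terms of `dz`, the kernel of `dz` lies in the radical of `Ω`; so `dz` is bijective and every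
  -- `z_i` vanishes.
  have key : ∀ q ∈ z.source, IsCriticalPoint I IC π q → z q = 0 := by
    intro q hq hcrit
    let dz : E →L[ℂ] EuclideanSpace ℂ (Fin n ⊕ Fin n) :=
      mfderiv I 𝓘(ℂ, EuclideanSpace ℂ (Fin n ⊕ Fin n)) z q
    have hinj : Function.Injective dz := by
      rw [injective_iff_map_eq_zero]
      intro v hv
      refine hΩ.nondegenerate q v fun w => ?_
      have h0 : diff I z q v = 0 := hv
      rw [hform q hq v w, h0]
      simp
    have hrank : Module.finrank ℂ E =
        Module.finrank ℂ (EuclideanSpace ℂ (Fin n ⊕ Fin n)) := hz.finrank_eq.symm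
    have hsurj : Function.Surjective dz := by
      rcases Nat.eq_zero_or_pos n with rfl | hn
      · exact fun y => ⟨0, Subsingleton.elim _ _⟩
      have : FiniteDimensional ℂ E := .of_finrank_pos (by omega)
      exact (LinearMap.injective_iff_surjective_of_finrank_eq_finrank hrank
        (f := (dz : E →ₗ[ℂ] EuclideanSpace ℂ (Fin n ⊕ Fin n)))).1 hinj
    have h1 : HasMFDerivAt I 𝓘(ℂ, ℂ) (ψ ∘ π) q
        ((mfderiv IC 𝓘(ℂ, ℂ) ψ (π q)).comp (mfderiv I IC π q)) :=
      (hψ.mdifferentiableAt (hmaps hq)).hasMFDerivAt.comp q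
        ((hπ q).mdifferentiableAt (by simp)).hasMFDerivAt
    let g : EuclideanSpace ℂ (Fin n ⊕ Fin n) → ℂ := fun u => ∑ i, u i ^ 2
    have hg : HasFDerivAt g (∑ i, (2 * z q i) •
        (EuclideanSpace.proj i : EuclideanSpace ℂ (Fin n ⊕ Fin n) →L[ℂ] ℂ)) (z q) := by
      refine HasFDerivAt.fun_sum fun i _ => ?_
      have := ((EuclideanSpace.proj i : EuclideanSpace ℂ (Fin n ⊕ Fin n) →L[ℂ] ℂ).hasFDerivAt
        (x := z q)).pow 2
      simpa using this
    have h2 : HasMFDerivAt I 𝓘(ℂ, ℂ) (g ∘ z) q (_ ∘L dz) :=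
      hg.hasMFDerivAt.comp q (hz.mdifferentiableAt hq).hasMFDerivAt
    have h3 : HasMFDerivAt I 𝓘(ℂ, ℂ) (ψ ∘ π) q (_ ∘L dz) :=
      h2.congr_of_eventuallyEq (by
        filter_upwards [hz.open_source.mem_nhds hq] with y hy using hsq y hy)
    have h4 := hasMFDerivAt_unique h1 h3
    ext i
    obtain ⟨v, hv⟩ := hsurj (EuclideanSpace.single i 1)
    have h5 : (mfderiv IC 𝓘(ℂ, ℂ) ψ (π q) : ℂ →L[ℂ] ℂ) ((mfderiv I IC π q : E →L[ℂ] ℂ) v) =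
        (∑ i, (2 * z q i) • (EuclideanSpace.proj i : EuclideanSpace ℂ (Fin n ⊕ Fin n) →L[ℂ] ℂ))
          (dz v) := DFunLike.congr_fun h4 v
    rw [mfderiv_eq_zero_of_isCriticalPoint hcrit v, map_zero, hv] at h5
    have h6 : (2 : ℂ) * z q i = 0 := by
      simp [-Fintype.sum_sum_type, PiLp.single_apply] at h5
      exact h5.symm
    exact (mul_eq_zero.1 h6).resolve_left two_ne_zero
  exact ⟨z.source, hz.open_source.mem_nhds hpz, fun q hq hcrit =>
    z.injOn hq hpz ((key q hq hcrit).trans (key p hpz hp).symm)⟩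

/-- The regular points of a holomorphic function form an open set. -/
theorem exists_mem_nhds_forall_not_isCriticalPoint [IsManifold I ∞ X] [IsManifold IC ∞ C]
    {π : X → C} (hπ : ContMDiff I IC ∞ π) {p : X} (hp : ¬ IsCriticalPoint I IC π p) :
    ∃ W ∈ 𝓝 p, ∀ q ∈ W, ¬ IsCriticalPoint I IC π q := by
  let D : X → E →L[ℂ] ℂ := fun q => mfderiv I IC π q
  -- Regular means `dπ ≠ 0`, which is an open condition once `dπ` is read in fixed trivializations
  -- of the tangent bundles.
  have h : ContinuousAt (inTangentCoordinates I IC id π D p) p :=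
    (ContMDiffAt.mfderiv_const (m := 0) (hπ p) (by simp)).continuousAt
  have hne : inTangentCoordinates I IC id π D p p ≠ 0 := by
    rw [inTangentCoordinates_eq id π D (mem_chart_source H p) (mem_chart_source HC (π p))]
    intro h0
    obtain ⟨v, hv⟩ : ∃ v : E, D p v = 1 := not_not.1 hp (1 : ℂ)
    have h1 := DFunLike.congr_fun h0 v
    have h2 : (tangentBundleCore I X).coordChange (achart H p) (achart H p) p v = v :=
      (tangentBundleCore I X).coordChange_self (achart H p) p (mem_chart_source H p) v
    have h3 : (tangentBundleCore IC C).coordChange (achart HC (π p)) (achart HC (π p)) (π p)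
        (D p v) = D p v :=
      (tangentBundleCore IC C).coordChange_self (achart HC (π p)) (π p)
        (mem_chart_source HC (π p)) (D p v)
    have h4 : D p v = 0 := h3.symm.trans ((congrArg (fun u : E =>
      (tangentBundleCore IC C).coordChange (achart HC (π p)) (achart HC (π p)) (π p) (D p u))
        h2.symm).trans h1)
    exact one_ne_zero (hv.symm.trans h4)
  refine ⟨_, h.preimage_mem_nhds (isOpen_ne.mem_nhds hne), fun q hq hcrit => hq ?_⟩
  have h0 : D q = 0 :=
    ContinuousLinearMap.ext fun v => mfderiv_eq_zero_of_isCriticalPoint hcrit v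
  simp only [inTangentCoordinates, ContinuousLinearMap.inCoordinates]
  rw [h0]
  exact ContinuousLinearMap.ext fun u => (Bundle.Trivialization.continuousLinearMapAt ℂ
    (trivializationAt ℂ (TangentSpace IC) (π p)) (π q)).map_zero

/-- The critical values of a closed map with isolated critical points are isolated. -/
theorem exists_mem_nhds_forall_isRegularValue [IsManifold I ∞ X] [IsManifold IC ∞ C] {n : ℕ}
    {Ω : TwoForm I X} {π : X → C} (hπ : IsHolomorphicSymplecticLefschetzFibration n I IC Ω π)
    (hc : IsClosedMap π) (c : C) :
    ∃ N ∈ 𝓝 c, ∀ c' ∈ N, c' ≠ c → IsRegularValue I IC π c' := by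
  have hloc : ∀ x, π x = c → ∃ W ∈ 𝓝 x, ∀ q ∈ W, IsCriticalPoint I IC π q → π q = c := by
    intro x hx
    by_cases hcrit : IsCriticalPoint I IC π x
    · obtain ⟨W, hW, h⟩ := exists_mem_nhds_forall_isCriticalPoint_eq hπ.dim_eq hπ.symplectic
        hπ.holomorphic hcrit (hπ.morseDarboux x hcrit)
      exact ⟨W, hW, fun q hq hq' => by rw [h q hq hq', hx]⟩
    · obtain ⟨W, hW, h⟩ := exists_mem_nhds_forall_not_isCriticalPoint hπ.holomorphic hcrit
      exact ⟨W, hW, fun q hq hq' => (h q hq hq').elim⟩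
  -- Near the fibre over `c` all critical points lie on that fibre; closedness of `π` turns this
  -- neighbourhood of the fibre into one of `c`.
  let O : Set X := interior {q | IsCriticalPoint I IC π q → π q = c}
  have hO : π ⁻¹' {c} ⊆ O := fun x hx => by
    obtain ⟨W, hW, h⟩ := hloc x hx
    exact mem_interior_iff_mem_nhds.2 (mem_of_superset hW h)
  refine ⟨(π '' Oᶜ)ᶜ, (hc _ isOpen_interior.isClosed_compl).isOpen_compl.mem_nhds ?_, ?_⟩
  · rintro ⟨x, hx, hxc⟩
    exact hx (hO hxc)
  · intro c' hc' hne q hq hcrit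
    have hqO : q ∈ O := by
      by_contra h
      exact hc' ⟨q, h, hq⟩
    have : π q = c := (interior_subset hqO : q ∈ {q | IsCriticalPoint I IC π q → π q = c}) hcrit
    exact hne (hq.symm.trans this)

end Critical

/-! ### The focus-focus normal form at critical points. -/

section FocusFocus

variable {E : Type*} [NormedAddCommGroup E] [NormedSpace ℂ E] {H : Type*} [TopologicalSpace H]
  {I : ModelWithCorners ℂ E H} {X : Type*} [TopologicalSpace X] [ChartedSpace H X]
  {HC : Type*} [TopologicalSpace HC] {IC : ModelWithCorners ℂ ℂ HC}
  {C : Type*} [TopologicalSpace C] [ChartedSpace HC C]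
  {V : Type*} [NormedAddCommGroup V] [NormedSpace ℂ V]
  {W : Type*} [NormedAddCommGroup W] [NormedSpace ℝ W]

/-- A holomorphic chart followed by a real linear isomorphism is a smooth chart. -/
theorem IsLocalChart.real {φ : PartialEquiv X V} (h : IsLocalChart I φ) (Θ : V ≃L[ℝ] W) :
    IsLocalChart (realModel I) (φ.transEquiv Θ.toEquiv) where
  finrank_eq := by
    rw [← Θ.toLinearEquiv.finrank_eq, finrank_real_of_complex, finrank_real_of_complex,
      h.finrank_eq]
  open_source := h.open_source
  contMDiffOn := Θ.contDiff.contMDiff.comp_contMDiffOn (h.contMDiffOn.real)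
  contMDiffOn_symm := (h.contMDiffOn_symm.real).comp Θ.symm.contDiff.contMDiff.contMDiffOn
    (fun _ hw => hw)

theorem IsLocalChart.diff_real {φ : PartialEquiv X V} (h : IsLocalChart I φ) (Θ : V ≃L[ℝ] W)
    {q : X} (hq : q ∈ φ.source) (v : E) :
    diff (realModel I) (φ.transEquiv Θ.toEquiv) q v = Θ (diff I φ q v) := by
  have h1 := h.mdifferentiableAt hq
  have h2 : MDifferentiableAt (realModel I) 𝓘(ℝ, V) φ q :=
    MDifferentiableWithinAt.real h1
  have h3 : HasMFDerivAt (realModel I) 𝓘(ℝ, W) (Θ ∘ φ) q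
      ((Θ : V →L[ℝ] W).comp (mfderiv (realModel I) 𝓘(ℝ, V) φ q)) :=
    (Θ : V →L[ℝ] W).hasFDerivAt.hasMFDerivAt.comp q h2.hasMFDerivAt
  have h4 : mfderiv (realModel I) 𝓘(ℝ, W) (φ.transEquiv Θ.toEquiv) q =
      (Θ : V →L[ℝ] W).comp (mfderiv (realModel I) 𝓘(ℝ, V) φ q) := h3.mfderiv
  have h5 := mfderiv_realModel h1 v
  exact (DFunLike.congr_fun h4 v).trans (congrArg Θ h5)

/-- The coordinates `x₁ - i x₂ = (a + i b) / 2i` and `y₁ + i y₂ = a - i b` on `ℂ²`. -/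
def focusFocusEquiv :
    EuclideanSpace ℂ (Fin 1 ⊕ Fin 1) ≃L[ℝ] EuclideanSpace ℝ (Fin 2 ⊕ Fin 2) :=
  LinearEquiv.toContinuousLinearEquiv
    { toFun := fun u => WithLp.toLp 2 (Sum.elim
        ![((u (.inl 0)).im + (u (.inr 0)).re) / 2, ((u (.inl 0)).re - (u (.inr 0)).im) / 2]
        ![(u (.inl 0)).re + (u (.inr 0)).im, (u (.inl 0)).im - (u (.inr 0)).re])
      invFun := fun w => WithLp.toLp 2 (Sum.elim
        (fun _ => ⟨w (.inl 1) + w (.inr 0) / 2, w (.inl 0) + w (.inr 1) / 2⟩)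
        (fun _ => ⟨w (.inl 0) - w (.inr 1) / 2, w (.inr 0) / 2 - w (.inl 1)⟩))
      map_add' := fun u v => by
        ext (i | i) <;> fin_cases i <;> simp <;> ring
      map_smul' := fun r u => by
        ext (i | i) <;> fin_cases i <;> simp <;> ring
      left_inv := fun u => by
        ext (i | i) <;> fin_cases i <;> apply Complex.ext <;> simp <;> ring
      right_inv := fun w => by
        ext (i | i) <;> fin_cases i <;> simp <;> ring }

/-- The real and imaginary parts of `ζ / 2i`. -/
def divTwoIEquiv : ℂ ≃L[ℝ] EuclideanSpace ℝ (Fin 2) :=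
  LinearEquiv.toContinuousLinearEquiv
    { toFun := fun ζ => !₂[ζ.im / 2, -ζ.re / 2]
      invFun := fun w => ⟨-2 * w 1, 2 * w 0⟩
      map_add' := fun ζ ξ => by
        ext i; fin_cases i <;> simp <;> ring
      map_smul' := fun r ζ => by
        ext i; fin_cases i <;> simp <;> ring
      left_inv := fun ζ => by
        apply Complex.ext <;> simp <;> ring
      right_inv := fun w => by
        ext i; fin_cases i <;> simp }

/-- Let `a`, `b` be the two coordinates, so `Ω = db ∧ da` and `ψ ∘ π = a² + b²`. In the coordinates
of `focusFocusEquiv`, `(x₁ - i x₂)(y₁ + i y₂) = (a² + b²) / 2i`, whose real and imaginary parts are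
the two required components, and `d(x₁ - i x₂) ∧ d(y₁ + i y₂) = db ∧ da`, whose real part is the
standard form. -/
theorem HasMorseDarbouxCharts.isFocusFocusPoint {Ω : TwoForm I X} {π : X → C} {p : X}
    (h : HasMorseDarbouxCharts 1 I IC Ω π p) :
    IsFocusFocusPoint (realModel I) (realModel IC) (Ω.re I) π p := by
  obtain ⟨z, ψ, hz, hψ, hpz, hmaps, hform, hsq⟩ := h
  refine ⟨z.transEquiv focusFocusEquiv.toEquiv, ψ.transEquiv divTwoIEquiv.toEquiv, hz.real _,
    hψ.real _, hpz, hmaps, ?_, ?_⟩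
  · intro q hq v w
    have h1 := hz.diff_real focusFocusEquiv (q := q) hq v
    have h2 := hz.diff_real focusFocusEquiv (q := q) hq w
    rw [h1, h2]
    have h3 : (Ω.re I) q ![v, w] = (Ω q ![v, w]).re := rfl
    rw [h3, hform q hq v w]
    generalize diff I z q v = a
    generalize diff I z q w = b
    simp [focusFocusEquiv, Fin.sum_univ_two]
    ring
  · intro q hq
    have h1 := hsq q hq
    simp only [Fintype.sum_sum_type, Finset.univ_unique, Fin.default_eq_zero, Fin.isValue,
      Finset.sum_singleton] at h1
    refine ⟨fun j hj => absurd hj (Nat.not_lt_zero _), ?_, ?_⟩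
    · intro i j hi hj
      obtain rfl : i = 0 := hi
      obtain rfl : j = 1 := Fin.ext hj
      have h2 : ∀ k, (ψ.transEquiv divTwoIEquiv.toEquiv) (π q) k =
          (!₂[(ψ (π q)).im / 2, -(ψ (π q)).re / 2] : EuclideanSpace ℝ (Fin 2)) k := fun k => rfl
      have h3 : ∀ k, (z.transEquiv focusFocusEquiv.toEquiv) q k = focusFocusEquiv (z q) k :=
        fun k => rfl
      simp only [h2, h3, h1]
      generalize z q = u
      constructor <;> simp [focusFocusEquiv, pow_two] <;> ring
    · intro j _ hj hj'
      fin_cases j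
      · exact (hj rfl).elim
      · exact (hj' 0 rfl rfl).elim

theorem isBlockPattern_focusFocus : IsBlockPattern 2 0 ({0} : Set (Fin 2)) := by
  refine ⟨by norm_num, fun i hi => ⟨Nat.zero_le _, 1, ?_, ?_⟩⟩
  · obtain rfl : i = 0 := hi
    rfl
  · exact fun h => absurd h (by simp)

end FocusFocus

/-! ### Submersion charts at interior points. -/

section AdaptedChart

variable {E : Type*} [NormedAddCommGroup E] [NormedSpace ℝ E]
  {H : Type*} [TopologicalSpace H] {I : ModelWithCorners ℝ E H} {M : Type*} [TopologicalSpace M]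
  [ChartedSpace H M] {d : ℕ}
  {F : Type*} [NormedAddCommGroup F] [NormedSpace ℝ F]
  {G : Type*} [TopologicalSpace G] {J : ModelWithCorners ℝ F G} {N : Type*} [TopologicalSpace N]
  [ChartedSpace G N]

/-- The preferred chart at `x`, restricted to the interior of the manifold. -/
def interiorChart (I : ModelWithCorners ℝ E H) (x : M) : PartialEquiv M E where
  toFun := extChartAt I x
  invFun := (extChartAt I x).symm
  source := (extChartAt I x).source ∩ extChartAt I x ⁻¹' interior (extChartAt I x).target
  target := interior (extChartAt I x).target
  map_source' _ hy := hy.2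
  map_target' y hy := ⟨(extChartAt I x).map_target (interior_subset hy), by
    rwa [mem_preimage, (extChartAt I x).right_inv (interior_subset hy)]⟩
  left_inv' _ hy := (extChartAt I x).left_inv hy.1
  right_inv' _ hy := (extChartAt I x).right_inv (interior_subset hy)

theorem isOpenChart_interiorChart [IsManifold I ∞ M] (x : M) :
    IsOpenChart I (interiorChart I x) where
  open_source := (continuousOn_extChartAt x).isOpen_inter_preimage (isOpen_extChartAt_source x)
    isOpen_interior
  open_target := isOpen_interior
  contMDiffOn := contMDiffOn_extChartAt.mono fun y hy => by
    rw [← extChartAt_source I]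
    exact hy.1
  contMDiffOn_symm := (contMDiffOn_extChartAt_symm x).mono interior_subset

theorem mem_interiorChart_source {x : M} (hx : x ∈ I.interior M) :
    x ∈ (interiorChart I x).source :=
  ⟨mem_extChartAt_source x, I.isInteriorPoint_iff.1 hx⟩

/-- A submersion has adapted charts at interior points. -/
theorem exists_isAdaptedChart [FiniteDimensional ℝ E] [FiniteDimensional ℝ F] [IsManifold I ∞ M]
    [IsManifold J ∞ N] (hd : Module.finrank ℝ E = Module.finrank ℝ F + d) {f : M → N}
    (hf : ContMDiff I J ∞ f) {x : M} (hx : x ∈ I.interior M) (hfx : f x ∈ J.interior N)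
    (hsurj : ¬ IsCriticalPoint I J f x) :
    ∃ κ : PartialEquiv M (F × EuclideanSpace ℝ (Fin d)), x ∈ κ.source ∧
      IsAdaptedChart I f (interiorChart J (f x)) κ := by
  have := FiniteDimensional.complete ℝ E
  have hφ := isOpenChart_interiorChart (I := I) x
  have hxφ := mem_interiorChart_source hx
  have hχ := isOpenChart_interiorChart (I := J) (f x)
  have hfχ := mem_interiorChart_source hfx
  set φ := interiorChart I x with hφdef
  set χ := interiorChart J (f x) with hχdef
  let A : E →L[ℝ] F := mfderiv I J f x
  have hA : Function.Surjective A := not_not.1 hsurj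
  let O : Set E := φ.target ∩ φ.symm ⁻¹' (f ⁻¹' χ.source)
  have hO : IsOpen O := hφ.contMDiffOn_symm.continuousOn.isOpen_inter_preimage hφ.open_target
    (hχ.open_source.preimage hf.continuous)
  have hg : ContDiffOn ℝ ∞ (fun y => χ (f (φ.symm y))) O := by
    rw [← contMDiffOn_iff_contDiffOn]
    exact hχ.contMDiffOn.comp (hf.comp_contMDiffOn (hφ.contMDiffOn_symm.mono inter_subset_left))
      (fun y hy => hy.2)
  have hsymm : φ.symm (φ x) = x := φ.left_inv hxφ
  have hxO : φ x ∈ O := ⟨φ.map_source hxφ, by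
    rw [mem_preimage, hsymm]
    exact hfχ⟩
  have hgA : HasFDerivAt (fun y => χ (f (φ.symm y))) A (φ x) := by
    have h1 : MDifferentiableAt I J f x := (hf x).mdifferentiableAt (by simp)
    have h2 := ((hg.contDiffAt (hO.mem_nhds hxO)).differentiableAt (by simp)).hasFDerivAt
    have h3 : A = fderivWithin ℝ (writtenInExtChartAt I J x f) (range I) (extChartAt I x x) :=
      h1.mfderiv
    have h4 : range I ∈ 𝓝 (extChartAt I x x) := range_mem_nhds_isInteriorPoint hx
    rw [h3, fderivWithin_of_mem_nhds h4]
    exact h2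
  have hker : Module.finrank ℝ (LinearMap.ker (A : E →ₗ[ℝ] F)) = d := by
    have h1 := LinearMap.finrank_range_add_finrank_ker (A : E →ₗ[ℝ] F)
    rw [LinearMap.range_eq_top.2 hA, finrank_top, hd] at h1
    omega
  -- A linear projection onto `ker A` supplies the missing `d` coordinates: `(A, L)` is injective
  -- between spaces of equal dimension.
  obtain ⟨P, hP⟩ := LinearMap.exists_leftInverse_of_injective
    (LinearMap.ker (A : E →ₗ[ℝ] F)).subtype (Submodule.ker_subtype _)
  let ι : LinearMap.ker (A : E →ₗ[ℝ] F) ≃ₗ[ℝ] EuclideanSpace ℝ (Fin d) :=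
    LinearEquiv.ofFinrankEq _ _ (by rw [hker, finrank_euclideanSpace_fin])
  let L : E →L[ℝ] EuclideanSpace ℝ (Fin d) := LinearMap.toContinuousLinearMap (ι.toLinearMap ∘ₗ P)
  have hinj : Function.Injective (A.prod L) := by
    rw [injective_iff_map_eq_zero]
    intro v hv
    have h1 : A v = 0 := congrArg Prod.fst hv
    have h2 : ι (P v) = 0 := congrArg Prod.snd hv
    have h3 : P v = ⟨v, h1⟩ := DFunLike.congr_fun hP ⟨v, h1⟩
    rw [h3, map_eq_zero_iff ι ι.injective] at h2
    exact congrArg Subtype.val h2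
  let T : E ≃L[ℝ] F × EuclideanSpace ℝ (Fin d) :=
    (LinearMap.linearEquivOfInjective (A.prod L : E →ₗ[ℝ] F × EuclideanSpace ℝ (Fin d)) hinj
      (by rw [Module.finrank_prod, finrank_euclideanSpace_fin, hd])).toContinuousLinearEquiv
  obtain ⟨e, hxe, heO, hev, hes⟩ := exists_openPartialHomeomorph_of_contDiffOn hO
    (hg.prodMk L.contDiff.contDiffOn) hxO T (hgA.prodMk L.hasFDerivAt)
  have hesm : ContDiffOn ℝ ∞ e e.source :=
    ((hg.prodMk L.contDiff.contDiffOn).mono heO).congr fun y _ => hev y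
  refine ⟨φ.trans e.toPartialEquiv, ⟨hxφ, hxe⟩, ⟨⟨?_, ?_, ?_, ?_⟩, ?_, ?_⟩⟩
  · exact hφ.contMDiffOn.continuousOn.isOpen_inter_preimage hφ.open_source e.open_source
  · exact e.continuousOn_symm.isOpen_inter_preimage e.open_target hφ.open_target
  · exact hesm.contMDiffOn.comp (hφ.contMDiffOn.mono inter_subset_left) fun y hy => hy.2
  · exact hφ.contMDiffOn_symm.comp (hes.contMDiffOn.mono inter_subset_left) fun y hy => hy.2
  · rintro y ⟨hy, hye⟩
    have : f (φ.symm (φ y)) ∈ χ.source := (heO hye).2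
    rwa [φ.left_inv hy] at this
  · rintro y ⟨hy, hye⟩
    change (e (φ y)).1 = _
    rw [hev, φ.left_inv hy]

end AdaptedChart

/-! ### Punctured neighbourhoods in a complex curve. -/

section Punctured

/-- A convex open subset of the plane remains connected when a point is removed. -/
theorem isPreconnected_diff_singleton {U : Set ℂ} (hU : IsOpen U) (hc : Convex ℝ U) (p : ℂ) :
    IsPreconnected (U \ {p}) := by
  by_cases hp : p ∈ U
  swap
  · rw [sdiff_singleton_eq_self hp]
    exact hc.isPreconnected
  obtain ⟨ε, hε, hball⟩ := Metric.isOpen_iff.1 hU p hp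
  -- The punctured set is the union of its four convex parts to the right of, above, to the left of
  -- and below `p`. The diagonal points at offset `ε / 3` lie in the `ε`-ball and witness the
  -- overlaps.
  have hmem : ∀ a b : ℝ, |a| = 1 → |b| = 1 →
      p + ⟨a * (ε / 3), b * (ε / 3)⟩ ∈ U := fun a b ha hb => by
    refine hball ?_
    rw [Metric.mem_ball, dist_self_add_left]
    refine (Complex.norm_le_abs_re_add_abs_im _).trans_lt ?_
    simp only [abs_mul, ha, hb, one_mul, abs_of_pos (show 0 < ε / 3 by linarith)]
    linarith
  have hre : ∀ r : ℝ, Convex ℝ (U ∩ {z : ℂ | r < z.re}) := fun r =>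
    hc.inter (convex_halfSpace_re_gt r)
  have hre' : ∀ r : ℝ, Convex ℝ (U ∩ {z : ℂ | z.re < r}) := fun r =>
    hc.inter (convex_halfSpace_re_lt r)
  have him : ∀ r : ℝ, Convex ℝ (U ∩ {z : ℂ | r < z.im}) := fun r =>
    hc.inter (convex_halfSpace_im_gt r)
  have him' : ∀ r : ℝ, Convex ℝ (U ∩ {z : ℂ | z.im < r}) := fun r =>
    hc.inter (convex_halfSpace_im_lt r)
  have h1 : IsPreconnected (U ∩ {z : ℂ | p.re < z.re} ∪ U ∩ {z : ℂ | p.im < z.im}) :=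
    IsPreconnected.union _ ⟨hmem 1 1 (by simp) (by simp), by simp [hε]⟩
      ⟨hmem 1 1 (by simp) (by simp), by simp [hε]⟩ (hre _).isPreconnected (him _).isPreconnected
  have h2 : IsPreconnected (U ∩ {z : ℂ | z.re < p.re} ∪ U ∩ {z : ℂ | z.im < p.im}) :=
    IsPreconnected.union _ ⟨hmem (-1) (-1) (by simp) (by simp), by simp [hε]⟩
      ⟨hmem (-1) (-1) (by simp) (by simp), by simp [hε]⟩ (hre' _).isPreconnected
      (him' _).isPreconnected
  have h3 := IsPreconnected.union (p + ⟨1 * (ε / 3), -1 * (ε / 3)⟩)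
    (Or.inl ⟨hmem 1 (-1) (by simp) (by simp), by simp [hε]⟩)
    (Or.inr ⟨hmem 1 (-1) (by simp) (by simp), by simp [hε]⟩) h1 h2
  convert h3 using 1
  ext z
  simp only [Set.mem_sdiff, mem_singleton_iff, mem_union, mem_inter_iff, Complex.ext_iff]
  constructor
  · rintro ⟨hz, hne⟩
    rcases lt_trichotomy z.re p.re with h | h | h
    · exact Or.inr (Or.inl ⟨hz, h⟩)
    · rcases lt_trichotomy z.im p.im with h' | h' | h'
      · exact Or.inr (Or.inr ⟨hz, h'⟩)
      · exact (hne ⟨h, h'⟩).elim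
      · exact Or.inl (Or.inr ⟨hz, h'⟩)
    · exact Or.inl (Or.inl ⟨hz, h⟩)
  · rintro ((⟨hz, h⟩ | ⟨hz, h⟩) | (⟨hz, h⟩ | ⟨hz, h⟩))
    · exact ⟨hz, fun h' => (ne_of_gt h) h'.1⟩
    · exact ⟨hz, fun h' => (ne_of_gt h) h'.2⟩
    · exact ⟨hz, fun h' => (ne_of_lt h) h'.1⟩
    · exact ⟨hz, fun h' => (ne_of_lt h) h'.2⟩

variable {HC : Type*} [TopologicalSpace HC] {IC : ModelWithCorners ℂ ℂ HC}
  {C : Type*} [TopologicalSpace C] [ChartedSpace HC C] [IsManifold IC ∞ C]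

/-- Near any point of a complex curve, the interior points other than the given one contain a
connected set which is dense near the point. -/
theorem exists_isPreconnected_subset_closure {N₀ : Set C} {c : C} (hN₀ : N₀ ∈ 𝓝 c) :
    ∃ N ∈ 𝓝 c, ∃ T : Set C, T ⊆ (IC.interior C ∩ N₀) \ {c} ∧ IsPreconnected T ∧ N ⊆ closure T := by
  let φ := extChartAt IC c
  have ht : φ.target ∈ 𝓝[range IC] φ c := extChartAt_target_mem_nhdsWithin c
  have hN : φ.symm ⁻¹' N₀ ∈ 𝓝 (φ c) := (continuousAt_extChartAt_symm c).preimage_mem_nhds (by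
    rwa [extChartAt_to_inv])
  obtain ⟨ε, hε, hball⟩ := Metric.mem_nhdsWithin_iff.1
    (inter_mem ht (mem_nhdsWithin_of_mem_nhds hN))
  -- Intersecting with the interior of the convex range treats boundary points uniformly: `U` is
  -- convex and open, and the range lies in the closure of its interior, so `U` is still dense near
  -- `φ c`.
  let U : Set ℂ := Metric.ball (φ c) ε ∩ interior (range IC)
  have hUo : IsOpen U := Metric.isOpen_ball.inter isOpen_interior
  have hUc : Convex ℝ U := (convex_ball _ _).inter (realModel IC).convex_range.interior
  have hUt : U ⊆ φ.target ∩ φ.symm ⁻¹' N₀ := fun w hw => hball ⟨hw.1, interior_subset hw.2⟩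
  refine ⟨φ.source ∩ φ ⁻¹' Metric.ball (φ c) ε, ?_, φ.symm '' (U \ {φ c}), ?_, ?_, ?_⟩
  · exact inter_mem (extChartAt_source_mem_nhds c)
      ((continuousAt_extChartAt c).preimage_mem_nhds (Metric.ball_mem_nhds _ hε))
  · rintro _ ⟨w, ⟨hwU, hwc⟩, rfl⟩
    have hw := hUt hwU
    have hs := φ.map_target hw.1
    refine ⟨⟨?_, hw.2⟩, fun h => hwc ?_⟩
    · have hs' : φ.symm w ∈ (chartAt HC c).source := by rwa [← extChartAt_source IC]
      refine (IC.isInteriorPoint_iff_of_mem_atlas (n := ∞) (by simp) (chart_mem_atlas HC c)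
        hs').2 ?_
      change φ (φ.symm w) ∈ interior φ.target
      rw [φ.right_inv hw.1]
      exact interior_maximal (fun z hz => (hUt hz).1) hUo hwU
    · rw [mem_singleton_iff, ← φ.right_inv hw.1, mem_singleton_iff.1 h]
  · refine (isPreconnected_diff_singleton hUo hUc _).image _ fun w hw => ?_
    exact (continuousAt_extChartAt_symm'' (hUt hw.1).1).continuousWithinAt
  · rintro y ⟨hys, hyB⟩
    have hyt := φ.map_source hys
    have h1 : φ y ∈ closure (interior (range IC)) :=
      IC.range_subset_closure_interior (extChartAt_target_subset_range c hyt)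
    have h2 : φ y ∈ closure U := Metric.isOpen_ball.inter_closure ⟨hyB, h1⟩
    have h3 : φ y ∈ closure (U \ {φ c}) :=
      closure_minimal ((dense_compl_singleton (φ c)).open_subset_closure_inter hUo)
        isClosed_closure h2
    have h4 := ((continuousAt_extChartAt_symm'' hyt).continuousWithinAt (s := U \ {φ c})
      ).mem_closure_image h3
    rwa [φ.left_inv hys] at h4

end Punctured

/-! ### The bundle over the interior regular values. -/

section Assembly

variable {E : Type*} [NormedAddCommGroup E] [NormedSpace ℂ E] {H : Type*} [TopologicalSpace H]
  {I : ModelWithCorners ℂ E H} {X : Type*} [TopologicalSpace X] [ChartedSpace H X]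
  {HC : Type*} [TopologicalSpace HC] {IC : ModelWithCorners ℂ ℂ HC}
  {C : Type*} [TopologicalSpace C] [ChartedSpace HC C]

/-- The regular values in the interior of the base. -/
def interiorRegularValues (I : ModelWithCorners ℂ E H) (IC : ModelWithCorners ℂ ℂ HC)
    (π : X → C) : Set C :=
  IC.interior C ∩ {c | IsRegularValue I IC π c}

variable {n : ℕ} {Ω : TwoForm I X} {π : X → C}

theorem isRegularValue_realModel (hπ : ContMDiff I IC ∞ π) {c : C} :
    IsRegularValue (realModel I) (realModel IC) π c ↔ IsRegularValue I IC π c :=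
  forall₂_congr fun p _ =>
    not_congr (isCriticalPoint_realModel ((hπ p).mdifferentiableAt (by simp)))

variable [IsManifold I ∞ X] [IsManifold IC ∞ C]

theorem isOpen_interiorRegularValues
    (hπ : IsHolomorphicSymplecticLefschetzFibration n I IC Ω π) (hc : IsClosedMap π) :
    IsOpen (interiorRegularValues I IC π) := by
  refine isOpen_iff_mem_nhds.2 fun c hcS => ?_
  obtain ⟨N, hN, h⟩ := exists_mem_nhds_forall_isRegularValue hπ hc c
  filter_upwards [hN, (IC.isOpen_interior (M := C) (n := ∞) (by simp)).mem_nhds hcS.1] with c' h1 h2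
  refine ⟨h2, ?_⟩
  by_cases hcc : c' = c
  · rw [hcc]
    exact hcS.2
  · exact h c' h1 hcc

theorem exists_isPreconnected_subset_interiorRegularValues
    (hπ : IsHolomorphicSymplecticLefschetzFibration n I IC Ω π) (hc : IsClosedMap π) (c : C) :
    ∃ N ∈ 𝓝 c, ∃ T ⊆ interiorRegularValues I IC π, IsPreconnected T ∧ N ⊆ closure T := by
  obtain ⟨N₀, hN₀, h⟩ := exists_mem_nhds_forall_isRegularValue hπ hc c
  obtain ⟨N, hN, T, hT, hT', hNT⟩ := exists_isPreconnected_subset_closure (IC := IC) hN₀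
  exact ⟨N, hN, T, fun t ht => ⟨(hT ht).1.1, h t (hT ht).1.2 (hT ht).2⟩, hT', hNT⟩

/-- A proper holomorphic symplectic Lefschetz fibration of real dimension four is a fibre bundle
over its interior regular values. -/
theorem isFibreBundleOver_interiorRegularValues [T2Space X] [T2Space C] [ConnectedSpace X]
    (hdim : Module.finrank ℝ E = 4)
    (hπ : IsHolomorphicSymplecticLefschetzFibration n I IC Ω π) (hp : IsProperMap π) :
    IsFibreBundleOver 2 (realModel I) (realModel IC) π (interiorRegularValues I IC π) := by
  have : FiniteDimensional ℝ E := .of_finrank_pos (by omega)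
  -- Connectedness of `X` enters here; it provides the single typical fibre.
  have : ConnectedSpace C := hπ.surjective.connectedSpace hp.continuous
  have hloc := exists_isPreconnected_subset_interiorRegularValues hπ hp.isClosedMap
  refine isFibreBundleOver_of_isPreconnected (isOpen_interiorRegularValues hπ hp.isClosedMap)
    (dense_of_locally_subset_closure hloc).nonempty (isPreconnected_of_locally_subset_closure hloc)
    fun c hc => ?_
  refine exists_isTrivialization (χ := interiorChart (realModel IC) c) hπ.holomorphic.real
    hp.isClosedMap (hp.isCompact_preimage isCompact_singleton) (hπ.surjective c)
    (isOpenChart_interiorChart c) (mem_interiorChart_source hc.1) fun x hx => ?_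
  subst hx
  refine exists_isAdaptedChart (by rw [hdim, Complex.finrank_real_complex]) hπ.holomorphic.real ?_
    hc.1 ((isRegularValue_realModel hπ.holomorphic).2 hc.2 x rfl)
  -- Since `∂X = π⁻¹(∂C)`, fibres over interior points avoid the boundary, as the adapted charts
  -- require.
  have h1 : x ∉ I.boundary X := by
    rw [hπ.boundary_eq]
    intro h2
    rw [← IC.compl_interior] at h2
    exact h2 hc.1
  rw [← I.compl_interior] at h1
  exact not_not.1 h1

end Assembly

end HoloLefschetz

end

theorem mainTheorem6
    {E : Type*} [NormedAddCommGroup E] [NormedSpace ℂ E]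
    {HX : Type*} [TopologicalSpace HX] {HC : Type*} [TopologicalSpace HC]
    (I : ModelWithCorners ℂ E HX) (hI : IsBoundaryModel I)
    (IC : ModelWithCorners ℂ ℂ HC) (hIC : IsBoundaryModel IC)
    {X : Type*} [TopologicalSpace X] [T2Space X] [SecondCountableTopology X]
    [ChartedSpace HX X] [IsManifold I ∞ X]
    {C : Type*} [TopologicalSpace C] [T2Space C] [SecondCountableTopology C]
    [ChartedSpace HC C] [IsManifold IC ∞ C]
    [ConnectedSpace X] (hdim : Module.finrank ℝ E = 4)
    (n : ℕ) (Ω : TwoForm I X) (π : X → C)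
    (hπ : IsHolomorphicSymplecticLefschetzFibration n I IC Ω π)
    (hproper : IsProperMap π ∨ CompactSpace X) :
    IsAlmostToricFibration 2 (realModel I) (realModel IC) (Ω.re I) π ∧
    (∀ c : C, IsRegularValue (realModel I) (realModel IC) π c →
      IsLagrangianFibre (realModel I) (realModel IC) (Ω.re I) π c) ∧
    (∀ p : X, IsCriticalPoint (realModel I) (realModel IC) π p →
      IsFocusFocusPoint (realModel I) (realModel IC) (Ω.re I) π p) := by
  -- A continuous map from a compact space to a Hausdorff space is proper, so both alternatives
  -- reduce to properness.
  have hp : IsProperMap π := hproper.elim id fun _ => hπ.holomorphic.continuous.isProperMap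
  have hE : Module.finrank ℂ E = 2 := by
    have := finrank_real_of_complex E
    omega
  obtain rfl : n = 1 := by
    have := hπ.dim_eq
    omega
  have hlag : ∀ c : C, IsRegularValue (realModel I) (realModel IC) π c →
      IsLagrangianFibre (realModel I) (realModel IC) (Ω.re I) π c :=
    fun c hc => isLagrangianFibre_re hE hπ.symplectic hπ.holomorphic hc
  have hff : ∀ p : X, IsCriticalPoint (realModel I) (realModel IC) π p →
      IsFocusFocusPoint (realModel I) (realModel IC) (Ω.re I) π p := fun p hcrit =>
    (hπ.morseDarboux p ((isCriticalPoint_realModel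
      ((hπ.holomorphic p).mdifferentiableAt (by simp))).1 hcrit)).isFocusFocusPoint
  refine ⟨?_, hlag, hff⟩
  exact
    { dim_total := by rw [hdim]
      dim_base := Complex.finrank_real_complex
      symplectic := hπ.symplectic.re
      smooth := hπ.holomorphic.real
      surjective := hπ.surjective
      lagrangian := ⟨interiorRegularValues I IC π, isOpen_interiorRegularValues hπ hp.isClosedMap,
        dense_of_locally_subset_closure
          (exists_isPreconnected_subset_interiorRegularValues hπ hp.isClosedMap),
        isFibreBundleOver_interiorRegularValues hdim hπ hp,
        fun c hc => hlag c ((isRegularValue_realModel hπ.holomorphic).2 hc.2)⟩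
      localForm := fun p hcrit => ⟨0, {0}, isBlockPattern_focusFocus, hff p hcrit⟩ }
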